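/- For all integers $0\le m<d$ there is a constant $f(d,m)>0$, depending only on $d$ and $m$, with the following property. Let $n\ge 1$, let the cube $Q=[0,n]^d$ be divided in the standard way into $n^d$ unit cubes, and let $Q_m$ be the $(m+1)$-skeleton of this partition (the union of its faces of dimension at most $m+1$). Let $T$ be any triangulation of $Q_m$ that subdivides its cubical faces (each simplex of $T$ lies in a cubical face of dimension at most $m+1$) and whose vertices are exactly the vertices of the partition, that is, the lattice points of $Q$. Suppose that the vertices of $T$ are colored so that no $(m+1)$-dimensional simplex of $T$ has $m+2$ different colors on its vertices. Then there is a color that is used on at least $f(d,m)\,n^{d-m}$ vertices of $T$; moreover, among the vertices of this color there is a connected set of at least $f(d,m)\,n^{d-m}$ vertices, where two vertices are called adjacent if they belong to a common $(m+1)$-dimensional simplex of $T$, and a set is connected if it is non-empty and any two of its vertices are joined by a path of successively adjacent vertices inside the set. -/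

import Mathlib

/-! The cube is `[0, n]^d`, divided in the standard way into `n ^ d` unit cubes. -/

namespace ColorCube

/-- The lattice points of the cube `[0, n]^d`, i.e. the vertices of its standard partition. -/
def latticePoints (d n : ℕ) : Set (Fin d → ℝ) :=
  {x | ∃ a : Fin d → ℕ, (∀ i, a i ≤ n) ∧ x = fun i => (a i : ℝ)}

/-- The unit cubical cell with least corner `a` and set `I` of edge directions: the product of the
intervals `[a i, a i + 1]` for `i ∈ I` and of the points `{a i}` for `i ∉ I`. -/
def cell {d : ℕ} (a : Fin d → ℕ) (I : Finset (Fin d)) : Set (Fin d → ℝ) :=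
  {x | ∀ i, (a i : ℝ) ≤ x i ∧ x i ≤ (a i : ℝ) + if i ∈ I then 1 else 0}

/-- `F` is a `k`-dimensional face of the standard partition of `[0, n]^d` into unit cubes. -/
def IsCubicalFace (d n k : ℕ) (F : Set (Fin d → ℝ)) : Prop :=
  ∃ (a : Fin d → ℕ) (I : Finset (Fin d)),
    (∀ i, a i + (if i ∈ I then 1 else 0) ≤ n) ∧ I.card = k ∧ F = cell a I

/-- The `k`-skeleton of the standard partition of `[0, n]^d`: the union of all the faces of
dimension at most `k`. -/
def skeleton (d n k : ℕ) : Set (Fin d → ℝ) :=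
  {x | ∃ j ≤ k, ∃ F, IsCubicalFace d n j F ∧ x ∈ F}

/-- `T` is a triangulation of the `k`-skeleton of the standard partition of `[0, n]^d` that
subdivides the cubical faces and has no vertices besides the lattice points. -/
structure IsSkeletonTriangulation (d n k : ℕ)
    (T : Geometry.SimplicialComplex ℝ (Fin d → ℝ)) : Prop where
  space_eq : T.space = skeleton d n k
  subdivides : ∀ σ ∈ T.faces, ∃ j ≤ k, ∃ F, IsCubicalFace d n j F ∧
    convexHull ℝ (σ : Set (Fin d → ℝ)) ⊆ F
  vertices_eq : T.vertices = latticePoints d n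

/-- The graph in which two distinct points are adjacent if they are vertices of a common
`k`-dimensional simplex of `T`. -/
def adjacencyGraph {d : ℕ} (T : Geometry.SimplicialComplex ℝ (Fin d → ℝ)) (k : ℕ) :
    SimpleGraph (Fin d → ℝ) where
  Adj u v := u ≠ v ∧ ∃ σ ∈ T.faces, σ.card = k + 1 ∧ u ∈ σ ∧ v ∈ σ
  symm := ⟨fun _ _ h => ⟨h.1.symm, by
    obtain ⟨σ, hσ, hc, hu, hv⟩ := h.2
    exact ⟨σ, hσ, hc, hv, hu⟩⟩⟩
  loopless := ⟨fun _ h => h.1 rfl⟩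

/-- The vertices of `T` that have color `c`. -/
def colorClass {d : ℕ} {C : Type*} (T : Geometry.SimplicialComplex ℝ (Fin d → ℝ))
    (color : (Fin d → ℝ) → C) (c : C) : Set (Fin d → ℝ) :=
  {v | v ∈ T.vertices ∧ color v = c}

end ColorCube

/-! A coloring is a simplicial map from `T` to the full simplex on the set of colors, and the
absence of rainbow `(m + 1)`-simplices says that the image lies in the `m`-skeleton. For a set `τ`
of colors let `c τ` be the mod 2 cochain on the grid that counts, in a cell of dimension `#τ - 1`,
the simplices colored bijectively by `τ`. Pulling back is compatible with coboundaries: `δ (c τ) = ∑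
c (insert v τ)` over `v ∉ τ` (`coboundary_colorCochain`). This rests on two parity counts,
`card_cofaces` (a triangulated cell is a pseudomanifold with boundary) and
`card_powersetCard_image_eq`.

If every color class is small, all these cochains have small support. For `#τ = m + 1` they are
cocycles, since the next ones vanish. A cocycle of positive degree in the grid is the coboundary of
a cochain whose support is larger by a factor of at most `d * (n + 1)` (`IsCocycle.exists_filling`,
by contracting one coordinate at a time). Descending from dimension `m` to `0`, the fillings found
in one dimension correct the cochains of the next lower one to cocycles
(`IsCorrection.exists_isCorrection`), at the cost of a factor of order `n` each time. In dimension
`0` the corrections cancel in the sum over all colors, so the corrected cocycles add up to `1` at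
the vertex `0` and one of them is nonzero there. A nonzero 0-cocycle lives on all `(n + 1) ^ d`
vertices (`IsCocycle.le_supportCard`), while its support is at most a constant times `n ^ m` times
the largest class. Hence some class has order at least `n ^ (d - m)`.

For the connected set, the same bound is applied to a finer coloring, in which the color of a vertex
is its monochromatic connected component. Two vertices of an `(m + 1)`-simplex with equal original
colors lie in one component, so this coloring has no rainbow simplex either. -/

namespace ColorCube

open Finset Function

variable {d : ℕ}

/-! ### Mod 2 cellular cochains of the grid and contracting homotopies. -/

/-- The dimension of a cell of the cubical grid. A cell is encoded by its doubled barycenter: an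
even coordinate `2 * a` stands for the point `a`, an odd one `2 * a + 1` for `[a, a + 1]`. -/
def cellDim (F : Fin d → ℕ) : ℕ := #{i | Odd (F i)}

/-- The cells of the standard partition of `[0, n]^d`. -/
def box (d n : ℕ) : Finset (Fin d → ℕ) := Fintype.piFinset fun _ => range (2 * n + 1)

theorem mem_box {n : ℕ} {F : Fin d → ℕ} : F ∈ box d n ↔ ∀ i, F i ≤ 2 * n := by
  simp [box]

theorem update_mem_box {n : ℕ} {F : Fin d → ℕ} (hF : F ∈ box d n) (i : Fin d) {e : ℕ}
    (he : e ≤ 2 * n) : update F i e ∈ box d n := by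
  rw [mem_box] at *
  intro j
  rcases eq_or_ne j i with rfl | h
  · simpa
  · simpa [h] using hF j

/-- The cellular coboundary modulo two. -/
def coboundary (z : (Fin d → ℕ) → ZMod 2) (F : Fin d → ℕ) : ZMod 2 :=
  ∑ i, if Odd (F i) then z (update F i (F i - 1)) + z (update F i (F i + 1)) else 0

/-- The number of cells of the grid in the support of a cochain. -/
def supportCard (n : ℕ) (z : (Fin d → ℕ) → ZMod 2) : ℕ := #{F ∈ box d n | z F ≠ 0}

/-- The part of the coboundary that does not change the `i`-th coordinate. -/
def coboundaryOff (i : Fin d) (z : (Fin d → ℕ) → ZMod 2) (F : Fin d → ℕ) (e : ℕ) : ZMod 2 :=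
  ∑ j ∈ univ.erase i, if Odd (F j) then
    z (update (update F j (F j - 1)) i e) + z (update (update F j (F j + 1)) i e) else 0

theorem coboundary_update (z : (Fin d → ℕ) → ZMod 2) (F : Fin d → ℕ) (i : Fin d) (e : ℕ) :
    coboundary z (update F i e) =
      (if Odd e then z (update F i (e - 1)) + z (update F i (e + 1)) else 0) +
        coboundaryOff i z F e := by
  unfold coboundary coboundaryOff
  rw [← add_sum_erase _ _ (mem_univ i)]
  congr 1
  · simp
  · refine sum_congr rfl fun j hj => ?_
    have hj : j ≠ i := ne_of_mem_erase hj
    simp only [update_of_ne hj]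
    rw [update_comm hj, update_comm hj]

/-- The homotopy contracting the `i`-th coordinate to the value `p`. -/
def contraction (i : Fin d) (p : ℕ) (z : (Fin d → ℕ) → ZMod 2) (F : Fin d → ℕ) : ZMod 2 :=
  if Even (F i) then
    -- Modulo two the common part of the sums cancels; what remains are the edges between the values
    -- `F i / 2` and `p`, in either order.
    ∑ l ∈ range (F i / 2), z (update F i (2 * l + 1)) + ∑ l ∈ range p, z (update F i (2 * l + 1))
  else 0

/-- The retraction of the `i`-th coordinate to the value `p`. -/
def retraction (i : Fin d) (p : ℕ) (z : (Fin d → ℕ) → ZMod 2) (F : Fin d → ℕ) : ZMod 2 :=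
  if Even (F i) then z (update F i (2 * p)) else 0

theorem coboundaryOff_contraction (i : Fin d) (p : ℕ) (z : (Fin d → ℕ) → ZMod 2) (F : Fin d → ℕ)
    (e : ℕ) : coboundaryOff i (contraction i p z) F e =
      if Even e then ∑ l ∈ range (e / 2), coboundaryOff i z F (2 * l + 1) +
        ∑ l ∈ range p, coboundaryOff i z F (2 * l + 1) else 0 := by
  unfold coboundaryOff contraction
  split_ifs with he
  · rw [sum_comm, sum_comm (s := range p), ← sum_add_distrib]
    refine sum_congr rfl fun j hj => ?_
    by_cases hj : Odd (F j)
    · simp only [hj, if_true, update_self, update_idem, if_pos he, sum_add_distrib]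
      ring
    · simp [hj]
  · simp [he]

theorem sum_range_telescope (g : ℕ → ZMod 2) (a : ℕ) :
    ∑ l ∈ range a, (g l + g (l + 1)) = g 0 + g a := by
  induction a with
  | zero => simp [CharTwo.add_self_eq_zero]
  | succ a ih =>
    rw [sum_range_succ, ih]
    linear_combination CharTwo.add_self_eq_zero (g a)

/-- The homotopy formula. The terms off direction `i` occur twice and cancel modulo two; in
direction `i` a telescoping sum (even coordinate) or a difference of consecutive sums (odd
coordinate) remains. -/
theorem coboundary_contraction (i : Fin d) (p : ℕ) (z : (Fin d → ℕ) → ZMod 2) (F : Fin d → ℕ) :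
    coboundary (contraction i p z) F + contraction i p (coboundary z) F =
      z F + retraction i p z F := by
  suffices h : ∀ e, coboundary (contraction i p z) (update F i e) + contraction i p (coboundary z) (update F i e) =
      z (update F i e) + retraction i p z (update F i e) by
    simpa using h (F i)
  intro e
  rw [coboundary_update, coboundaryOff_contraction]
  rcases Nat.even_or_odd' e with ⟨a, rfl | rfl⟩
  · have h1 : ∀ l, coboundary z (update F i (2 * l + 1)) =
        (z (update F i (2 * l)) + z (update F i (2 * (l + 1)))) +
          coboundaryOff i z F (2 * l + 1) := by
      intro l
      rw [coboundary_update, if_pos (by simp)]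
      rfl
    have h2 := sum_range_telescope fun l => z (update F i (2 * l))
    have ho : ¬ Odd (2 * a) := by simp
    have hd : 2 * a / 2 = a := by omega
    simp only [contraction, retraction, update_self, update_idem, even_two_mul, if_true, ho,
      if_false, hd, h1, sum_add_distrib (f := fun l => z _ + z _), h2]
    have h3 : (2 : ZMod 2) = 0 := rfl
    linear_combination (∑ l ∈ range a, coboundaryOff i z F (2 * l + 1) +
      ∑ l ∈ range p, coboundaryOff i z F (2 * l + 1) + z (update F i 0)) * h3
  · have he : ¬ Even (2 * a + 1) := by simp
    have hd : (2 * a + 1 + 1) / 2 = a + 1 := by omega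
    have h3 : (2 : ZMod 2) = 0 := rfl
    have he' : Even (2 * a + 1 + 1) := ⟨a + 1, by omega⟩
    simp only [contraction, retraction, update_self, update_idem, he, if_false, hd,
      Nat.add_sub_cancel, even_two_mul, if_true, he', sum_range_succ,
      show Odd (2 * a + 1) from ⟨a, rfl⟩, show 2 * a / 2 = a by omega]
    linear_combination (∑ l ∈ range a, z (update F i (2 * l + 1)) +
      ∑ l ∈ range p, z (update F i (2 * l + 1))) * h3

theorem coboundary_retraction (i : Fin d) (p : ℕ) (z : (Fin d → ℕ) → ZMod 2) (F : Fin d → ℕ) :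
    coboundary (retraction i p z) F = retraction i p (coboundary z) F := by
  suffices h : ∀ e, coboundary (retraction i p z) (update F i e) = retraction i p (coboundary z) (update F i e) by
    simpa using h (F i)
  intro e
  have hoff : coboundaryOff i (retraction i p z) F e =
      if Even e then coboundaryOff i z F (2 * p) else 0 := by
    unfold coboundaryOff retraction
    split_ifs with he <;> simp [he]
  rw [coboundary_update, hoff]
  rcases Nat.even_or_odd' e with ⟨a, rfl | rfl⟩
  · simp [retraction, coboundary_update, Nat.not_odd_iff_even.2 (even_two_mul _)]
  · have he' : Even (2 * a + 1 + 1) := ⟨a + 1, by omega⟩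
    simp [retraction, he', CharTwo.add_self_eq_zero]

/-! ### Cocycles, sizes of supports and the filling inequality. -/

/-- `z` is a cocycle on the grid. -/
def IsCocycle (n : ℕ) (z : (Fin d → ℕ) → ZMod 2) : Prop := ∀ F ∈ box d n, coboundary z F = 0

theorem IsCocycle.contraction_coboundary_eq_zero {n : ℕ} {z : (Fin d → ℕ) → ZMod 2}
    (hz : IsCocycle n z) (i : Fin d) {p : ℕ} (hp : p ≤ n) {F : Fin d → ℕ} (hF : F ∈ box d n) :
    contraction i p (coboundary z) F = 0 := by
  have := mem_box.1 hF i
  unfold contraction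
  split_ifs
  · rw [sum_eq_zero, sum_eq_zero, add_zero]
    all_goals
      intro l hl
      rw [mem_range] at hl
      exact hz _ (update_mem_box hF i (by omega))
  · rfl

theorem IsCocycle.eq_coboundary_add_retraction {n : ℕ} {z : (Fin d → ℕ) → ZMod 2}
    (hz : IsCocycle n z) (i : Fin d) {p : ℕ} (hp : p ≤ n) {F : Fin d → ℕ} (hF : F ∈ box d n) :
    z F = coboundary (contraction i p z) F + retraction i p z F := by
  have h := coboundary_contraction i p z F
  rw [hz.contraction_coboundary_eq_zero i hp hF, add_zero] at h
  rw [h]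
  linear_combination - CharTwo.add_self_eq_zero (retraction i p z F)

theorem IsCocycle.isCocycle_retraction {n : ℕ} {z : (Fin d → ℕ) → ZMod 2} (hz : IsCocycle n z) (i : Fin d)
    {p : ℕ} (hp : p ≤ n) : IsCocycle n (retraction i p z) := by
  intro F hF
  rw [coboundary_retraction]
  unfold retraction
  split_ifs
  · exact hz _ (update_mem_box hF i (by omega))
  · rfl

theorem cellDim_update_of_even {F : Fin d → ℕ} {i : Fin d} (hi : Even (F i)) {e : ℕ}
    (he : Even e) : cellDim (update F i e) = cellDim F := by
  unfold cellDim
  congr 1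
  ext j
  rcases eq_or_ne j i with rfl | h
  · simp [Nat.not_odd_iff_even.2 hi, Nat.not_odd_iff_even.2 he]
  · simp [h]

theorem cellDim_update_of_odd {F : Fin d → ℕ} {i : Fin d} (hi : Even (F i)) {e : ℕ}
    (he : Odd e) : cellDim (update F i e) = cellDim F + 1 := by
  unfold cellDim
  rw [← card_insert_of_notMem (a := i) (by simpa using hi)]
  congr 1
  ext j
  rcases eq_or_ne j i with rfl | h
  · simp [he]
  · simp [h]

theorem exists_of_contraction_ne_zero {i : Fin d} {p n : ℕ} (hp : p ≤ n)
    {z : (Fin d → ℕ) → ZMod 2} {F : Fin d → ℕ} (hF : F ∈ box d n) (h : contraction i p z F ≠ 0) :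
    Even (F i) ∧ ∃ l < n, z (update F i (2 * l + 1)) ≠ 0 := by
  have := mem_box.1 hF i
  unfold contraction at h
  split_ifs at h with he
  · refine ⟨he, ?_⟩
    by_contra! hc
    refine h ?_
    rw [sum_eq_zero, sum_eq_zero, add_zero]
    all_goals
      intro l hl
      rw [mem_range] at hl
      exact hc l (by omega)
  · exact absurd rfl h

theorem supportCard_contraction_le (i : Fin d) {p n : ℕ} (hp : p ≤ n)
    (z : (Fin d → ℕ) → ZMod 2) :
    supportCard n (contraction i p z) ≤ (n + 1) * supportCard n z := by
  classical
  unfold supportCard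
  calc _ ≤ #((range (n + 1) ×ˢ {G ∈ box d n | z G ≠ 0}).image
        fun q => update q.2 i (2 * q.1)) := by
        refine card_le_card fun F hF => ?_
        rw [mem_filter] at hF
        obtain ⟨⟨a, ha⟩, l, hl, hz⟩ := exists_of_contraction_ne_zero hp hF.1 hF.2
        have := mem_box.1 hF.1 i
        rw [mem_image]
        refine ⟨(a, update F i (2 * l + 1)), ?_, ?_⟩
        · simp only [mem_product, mem_range, mem_filter]
          exact ⟨by omega, update_mem_box hF.1 i (by omega), hz⟩
        · simp only [update_idem]
          rw [← two_mul] at ha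
          rw [← ha, update_eq_self]
    _ ≤ _ := card_image_le.trans (by rw [card_product, card_range])

theorem supportCard_retraction_le (i : Fin d) {p n : ℕ} (hp : p ≤ n)
    (z : (Fin d → ℕ) → ZMod 2) :
    supportCard n (retraction i p z) ≤
      (n + 1) * #{F ∈ box d n | z F ≠ 0 ∧ F i = 2 * p} := by
  classical
  unfold supportCard
  calc _ ≤ #((range (n + 1) ×ˢ {G ∈ box d n | z G ≠ 0 ∧ G i = 2 * p}).image
        fun q => update q.2 i (2 * q.1)) := by
        refine card_le_card fun F hF => ?_
        rw [mem_filter] at hF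
        have hz := hF.2
        unfold retraction at hz
        split_ifs at hz with he
        · obtain ⟨a, ha⟩ := he
          have := mem_box.1 hF.1 i
          rw [mem_image]
          refine ⟨(a, update F i (2 * p)), ?_, ?_⟩
          · simp only [mem_product, mem_range, mem_filter, update_self, and_true]
            exact ⟨by omega, update_mem_box hF.1 i (by omega), hz⟩
          · simp only [update_idem]
            rw [← two_mul] at ha
            rw [← ha, update_eq_self]
        · exact absurd rfl hz
    _ ≤ _ := card_image_le.trans (by rw [card_product, card_range])

/-- Averaging: the `n + 1` slices `F i = 2 * p` are disjoint, so one of them holds at most a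
fraction `1 / (n + 1)` of the support, and the retraction to it makes at most `n + 1` copies of that
slice. -/
theorem exists_supportCard_retraction_le (i : Fin d) (n : ℕ) (z : (Fin d → ℕ) → ZMod 2) :
    ∃ p ≤ n, supportCard n (retraction i p z) ≤ supportCard n z := by
  by_contra! h
  have h1 : ∀ p ∈ range (n + 1), supportCard n z <
      (n + 1) * #{F ∈ box d n | z F ≠ 0 ∧ F i = 2 * p} := fun p hp =>
    (h p (by simpa [Nat.lt_succ_iff] using hp)).trans_le
      (supportCard_retraction_le i (by simpa [Nat.lt_succ_iff] using hp) z)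
  have h2 := sum_lt_sum_of_nonempty (by simp) h1
  rw [sum_const, card_range, ← mul_sum, smul_eq_mul] at h2
  have h3 := lt_of_mul_lt_mul_left h2 (by positivity)
  refine h3.not_ge ?_
  rw [← card_biUnion]
  · unfold supportCard
    refine card_le_card fun F hF => ?_
    simp only [mem_biUnion, mem_filter] at hF ⊢
    obtain ⟨p, -, hF⟩ := hF
    exact ⟨hF.1, hF.2.1⟩
  · intro p _ q _ hpq
    refine disjoint_left.2 fun F hF hF' => hpq ?_
    have h1 := (mem_filter.1 hF).2.2
    have h2 := (mem_filter.1 hF').2.2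
    omega

theorem coboundary_add (z w : (Fin d → ℕ) → ZMod 2) (F : Fin d → ℕ) :
    coboundary (z + w) F = coboundary z F + coboundary w F := by
  unfold coboundary
  rw [← sum_add_distrib]
  refine sum_congr rfl fun i _ => ?_
  split_ifs
  · simp only [Pi.add_apply]; ring
  · simp

theorem coboundary_zero (F : Fin d → ℕ) :
    coboundary (0 : (Fin d → ℕ) → ZMod 2) F = 0 := by
  simp [coboundary]

theorem coboundary_sum {ι : Type*} (s : Finset ι) (z : ι → (Fin d → ℕ) → ZMod 2)
    (F : Fin d → ℕ) : coboundary (∑ j ∈ s, z j) F = ∑ j ∈ s, coboundary (z j) F := by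
  classical
  induction s using Finset.induction_on with
  | empty => simp [coboundary_zero]
  | insert a s ha ih => rw [sum_insert ha, sum_insert ha, coboundary_add, ih]

theorem supportCard_add_le (n : ℕ) (z w : (Fin d → ℕ) → ZMod 2) :
    supportCard n (z + w) ≤ supportCard n z + supportCard n w := by
  classical
  unfold supportCard
  refine le_trans (card_le_card fun F hF => ?_) (card_union_le _ _)
  simp only [mem_union, mem_filter, Pi.add_apply] at hF ⊢
  by_contra! hc
  exact hF.2 (by rw [hc.1 hF.1, hc.2 hF.1, add_zero])

theorem supportCard_zero (n : ℕ) : supportCard n (0 : (Fin d → ℕ) → ZMod 2) = 0 := by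
  simp [supportCard]

theorem supportCard_sum_le {ι : Type*} (n : ℕ) (s : Finset ι)
    (z : ι → (Fin d → ℕ) → ZMod 2) :
    supportCard n (∑ j ∈ s, z j) ≤ ∑ j ∈ s, supportCard n (z j) := by
  classical
  induction s using Finset.induction_on with
  | empty => simp [supportCard_zero]
  | insert a s ha ih =>
    rw [sum_insert ha, sum_insert ha]
    exact (supportCard_add_le _ _ _).trans (Nat.add_le_add_left ih _)

/-- A cochain is homogeneous of degree `k` on the grid. -/
def HasDegree (n k : ℕ) (z : (Fin d → ℕ) → ZMod 2) : Prop :=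
  ∀ F ∈ box d n, z F ≠ 0 → cellDim F = k

theorem HasDegree.add {n k : ℕ} {z w : (Fin d → ℕ) → ZMod 2} (hz : HasDegree n k z)
    (hw : HasDegree n k w) : HasDegree n k (z + w) := by
  intro F hF h
  by_contra hc
  exact h (by rw [Pi.add_apply, not_not.1 (mt (hz F hF) hc), not_not.1 (mt (hw F hF) hc), add_zero])

theorem HasDegree.zero (n k : ℕ) : HasDegree n k (0 : (Fin d → ℕ) → ZMod 2) :=
  fun _ _ h => absurd rfl h

theorem HasDegree.sum {ι : Type*} {n k : ℕ} (s : Finset ι) {z : ι → (Fin d → ℕ) → ZMod 2}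
    (hz : ∀ j ∈ s, HasDegree n k (z j)) : HasDegree n k (∑ j ∈ s, z j) := by
  classical
  induction s using Finset.induction_on with
  | empty => simpa using HasDegree.zero n k
  | insert a s ha ih =>
    rw [sum_insert ha]
    exact (hz a (mem_insert_self a s)).add (ih fun j hj => hz j (mem_insert_of_mem hj))

theorem HasDegree.hasDegree_contraction {n k : ℕ} {z : (Fin d → ℕ) → ZMod 2} (hz : HasDegree n (k + 1) z)
    (i : Fin d) {p : ℕ} (hp : p ≤ n) : HasDegree n k (contraction i p z) := by
  intro F hF h
  obtain ⟨he, l, hl, hne⟩ := exists_of_contraction_ne_zero hp hF h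
  have h1 := hz _ (update_mem_box hF i (by omega)) hne
  rw [cellDim_update_of_odd he ⟨l, rfl⟩] at h1
  omega

theorem HasDegree.hasDegree_retraction {n k : ℕ} {z : (Fin d → ℕ) → ZMod 2} (hz : HasDegree n k z)
    (i : Fin d) {p : ℕ} (hp : p ≤ n) : HasDegree n k (retraction i p z) := by
  intro F hF h
  unfold retraction at h
  split_ifs at h with he
  · have h1 := hz _ (update_mem_box hF i (by omega)) h
    rwa [cellDim_update_of_even he (by simp)] at h1
  · exact absurd rfl h

/-- The coordinates in `s` are contracted one after another. Each contraction adds at most `n + 1`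
times the support of the remainder `w`, which never grows because the value `p` is chosen by
averaging. -/
theorem IsCocycle.exists_partial_filling {n k : ℕ} {z : (Fin d → ℕ) → ZMod 2}
    (hz : IsCocycle n z) (hk : HasDegree n (k + 1) z) (s : Finset (Fin d)) :
    ∃ β w : (Fin d → ℕ) → ZMod 2, (∀ F ∈ box d n, z F = coboundary β F + w F) ∧
      IsCocycle n w ∧ HasDegree n (k + 1) w ∧ HasDegree n k β ∧
      (∀ F ∈ box d n, w F ≠ 0 → ∀ i ∈ s, Even (F i)) ∧
      supportCard n w ≤ supportCard n z ∧
      supportCard n β ≤ #s * (n + 1) * supportCard n z := by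
  induction s using Finset.induction_on with
  | empty =>
    refine ⟨0, z, fun F _ => by rw [coboundary_zero, zero_add], hz, hk, HasDegree.zero n k,
      by simp, le_rfl, by simp [supportCard_zero]⟩
  | insert i s hi ih =>
    obtain ⟨β, w, h1, h2, h3, h4, h5, h6, h7⟩ := ih
    obtain ⟨p, hp, hpw⟩ := exists_supportCard_retraction_le i n w
    refine ⟨β + contraction i p w, retraction i p w, fun F hF => ?_, h2.isCocycle_retraction i hp,
      h3.hasDegree_retraction i hp, h4.add (h3.hasDegree_contraction i hp), fun F hF hw j hj => ?_,
      hpw.trans h6, (supportCard_add_le _ _ _).trans ?_⟩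
    · rw [h1 F hF, coboundary_add, add_assoc, ← h2.eq_coboundary_add_retraction i hp hF]
    · unfold retraction at hw
      split_ifs at hw with he
      · rcases mem_insert.1 hj with rfl | hj
        · exact he
        · have := h5 _ (update_mem_box hF i (by omega)) hw j hj
          rwa [update_of_ne (ne_of_mem_of_not_mem hj hi)] at this
      · exact absurd rfl hw
    · rw [card_insert_of_notMem hi]
      have h8 := (supportCard_contraction_le i hp w).trans (Nat.mul_le_mul_left _ h6)
      calc _ ≤ _ := Nat.add_le_add h7 h8
        _ = _ := by ring

/-- The linear filling inequality for cocycles of positive degree in the grid. -/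
theorem IsCocycle.exists_filling {n k : ℕ} {z : (Fin d → ℕ) → ZMod 2}
    (hz : IsCocycle n z) (hk : HasDegree n (k + 1) z) :
    ∃ β : (Fin d → ℕ) → ZMod 2, (∀ F ∈ box d n, coboundary β F = z F) ∧ HasDegree n k β ∧
      supportCard n β ≤ d * (n + 1) * supportCard n z := by
  obtain ⟨β, w, h1, -, h3, h4, h5, -, h7⟩ := hz.exists_partial_filling hk univ
  refine ⟨β, fun F hF => ?_, h4, by simpa using h7⟩
  -- The remainder lives on cells with all coordinates even, that is, on vertices, but its degree is
  -- positive.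
  have hw : w F = 0 := by
    by_contra hw
    have h8 := h3 F hF hw
    rw [cellDim, filter_eq_empty_iff.2] at h8
    · simp at h8
    · intro i hi
      simpa using h5 F hF hw i hi
  rw [h1 F hF, hw, add_zero]

/-- A nonzero cocycle of degree zero is supported on all the vertices of the grid. -/
theorem IsCocycle.le_supportCard {n : ℕ} {z : (Fin d → ℕ) → ZMod 2}
    (hz : IsCocycle n z) (hk : HasDegree n 0 z) (h0 : z 0 ≠ 0) :
    (n + 1) ^ d ≤ supportCard n z := by
  classical
  have hstep : ∀ F ∈ box d n, ∀ i, Even (F i) → z F = z (update F i 0) := by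
    intro F hF i hi
    have h := coboundary_contraction i 0 z F
    rw [hz.contraction_coboundary_eq_zero i (Nat.zero_le n) hF, add_zero] at h
    -- Contraction lowers the degree, so it kills 0-cochains, and the homotopy formula says that `z`
    -- equals its retraction.
    have hc : ∀ G ∈ box d n, contraction i 0 z G = 0 := by
      intro G hG
      by_contra hne
      obtain ⟨he, l, hl, hne⟩ := exists_of_contraction_ne_zero (Nat.zero_le n) hG hne
      have h1 := hk _ (update_mem_box hG i (by omega)) hne
      rw [cellDim_update_of_odd he ⟨l, rfl⟩] at h1
      omega
    have hc' : coboundary (contraction i 0 z) F = 0 := by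
      unfold coboundary
      refine sum_eq_zero fun j _ => ?_
      have := mem_box.1 hF j
      split_ifs with ho
      · obtain ⟨a, ha⟩ := ho
        rw [hc _ (update_mem_box hF j (by omega)), hc _ (update_mem_box hF j (by omega)), add_zero]
      · rfl
    rw [hc', retraction, if_pos hi, mul_zero] at h
    linear_combination CharTwo.add_self_eq_zero (z F) + h
  have hall : ∀ F ∈ box d n, (∀ i, Even (F i)) → z F = z 0 := by
    intro F hF he
    have : ∀ s : Finset (Fin d), z F = z (fun i => if i ∈ s then 0 else F i) := by
      intro s
      induction s using Finset.induction_on with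
      | empty => simp
      | insert a s ha ih =>
        rw [ih, hstep _ _ a]
        · congr 1
          ext j
          rcases eq_or_ne j a with rfl | h
          · simp
          · simp [h]
        · simp only [ha, if_false, he]
        · rw [mem_box] at hF ⊢
          intro i
          split_ifs
          · omega
          · exact hF i
    simpa [Pi.zero_def] using this univ
  calc (n + 1) ^ d = #((Fintype.piFinset fun _ : Fin d => range (n + 1)).image
        fun a i => 2 * a i) := by
        rw [card_image_of_injective]
        · simp
        · intro a b hab
          ext i
          have := congrFun hab i
          dsimp only at this
          omega
    _ ≤ _ := by
      refine card_le_card fun F hF => ?_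
      simp only [mem_image, Fintype.mem_piFinset, mem_range] at hF
      obtain ⟨a, ha, rfl⟩ := hF
      have hb : (fun i => 2 * a i) ∈ box d n := mem_box.2 fun i => by have := ha i; omega
      rw [mem_filter]
      exact ⟨hb, by rwa [hall _ hb (by simp)]⟩

end ColorCube

/-! ### Descent: correcting color cochains to cocycles. -/

namespace ColorCube

open Finset Function

variable {d : ℕ} {C : Type*} [Fintype C] [DecidableEq C]

/-- This is `δ ∘ δ = 0` in the simplex on `C`: the pairs `(v, w)` and `(w, v)` give the same term.
-/
theorem sum_sum_insert_insert_eq_zero (τ : Finset C) (g : Finset C → ZMod 2) :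
    ∑ v ∈ τᶜ, ∑ w ∈ (insert v τ)ᶜ, g (insert w (insert v τ)) = 0 := by
  rw [sum_sigma']
  refine sum_involution (fun q _ => ⟨q.2, q.1⟩) ?_ ?_ ?_ ?_
  · rintro ⟨v, w⟩ -
    simp only
    rw [insert_comm]
    exact CharTwo.add_self_eq_zero _
  · rintro ⟨v, w⟩ h - h'
    simp only [mem_sigma, mem_compl, mem_insert, not_or] at h
    simp only [Sigma.mk.injEq, heq_eq_eq] at h'
    exact h.2.1 h'.1
  · rintro ⟨v, w⟩ h
    simp only [mem_sigma, mem_compl, mem_insert, not_or] at h ⊢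
    exact ⟨h.2.2, Ne.symm h.2.1, h.1⟩
  · rintro ⟨v, w⟩ -
    rfl

/-- A set of `k + 1` colors containing `v` arises once for each of its elements `w ≠ v`; the factor
`k + 1` is a crude bound for their number. -/
theorem sum_sum_insert_le (v : C) (k : ℕ) (g : Finset C → ℕ) :
    ∑ τ with #τ = k ∧ v ∈ τ, ∑ w ∈ τᶜ, g (insert w τ) ≤
      (k + 1) * ∑ τ with #τ = k + 1 ∧ v ∈ τ, g τ := by
  calc _ = ∑ τ with #τ = k + 1 ∧ v ∈ τ, ∑ w ∈ τ.erase v, g τ := by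
        rw [sum_sigma', sum_sigma']
        refine sum_bij' (fun q _ => ⟨insert q.2 q.1, q.2⟩) (fun q _ => ⟨q.1.erase q.2, q.2⟩)
          ?_ ?_ ?_ ?_ ?_
        · rintro ⟨τ, w⟩ h
          simp only [mem_sigma, mem_filter, mem_univ, true_and, mem_compl, mem_erase] at h ⊢
          exact ⟨⟨by rw [card_insert_of_notMem h.2, h.1.1], mem_insert_of_mem h.1.2⟩,
            fun hw => h.2 (hw ▸ h.1.2), mem_insert_self w τ⟩
        · rintro ⟨τ, w⟩ h
          simp only [mem_sigma, mem_filter, mem_univ, true_and, mem_compl, mem_erase] at h ⊢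
          exact ⟨⟨by rw [card_erase_of_mem h.2.2, h.1.1, Nat.add_sub_cancel],
            Ne.symm h.2.1, h.1.2⟩, by simp⟩
        · rintro ⟨τ, w⟩ h
          simp only [mem_sigma, mem_compl] at h
          simp [h.2]
        · rintro ⟨τ, w⟩ h
          simp only [mem_sigma, mem_erase] at h
          simp [insert_erase h.2.2]
        · rintro ⟨τ, w⟩ -
          rfl
    _ ≤ _ := by
        rw [mul_sum]
        refine sum_le_sum fun τ hτ => ?_
        rw [sum_const, smul_eq_mul]
        refine Nat.mul_le_mul_right _ ?_
        rw [← (mem_filter.1 hτ).2.1]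
        exact card_le_card (erase_subset _ _)

/-- A family of cochains on the grid `[0, n]^d`, indexed by the simplices of the full simplex on the
set `C` of colors, that behaves like the pullback of the cellular cochains along a map of the
`(m + 1)`-skeleton of the grid into the `m`-skeleton of the simplex. The number `K` bounds the total
support of the cochains of the simplices at a given vertex. -/
structure IsColorCochain (d n m K : ℕ) (c : Finset C → (Fin d → ℕ) → ZMod 2) : Prop where
  hasDegree : ∀ k τ, #τ = k + 1 → HasDegree n k (c τ)
  coboundary_eq : ∀ τ, τ.Nonempty → #τ ≤ m + 1 → ∀ F ∈ box d n,
    coboundary (c τ) F = ∑ v ∈ τᶜ, c (insert v τ) F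
  eq_zero : ∀ τ, #τ = m + 2 → ∀ F ∈ box d n, c τ F = 0
  augmentation : ∑ v, c {v} 0 = 1
  -- The bound is for each color separately, since the number of colors is not controlled.
  sum_supportCard_le : ∀ v, ∑ τ with v ∈ τ, supportCard n (c τ) ≤ K

/-- The cochains `b τ`, for `#τ = k + 2`, correct the cochains `c τ`, for `#τ = k + 1`, to
cocycles, and have supports of total size at most `B` at each color. -/
structure IsCorrection (n k B : ℕ) (c b : Finset C → (Fin d → ℕ) → ZMod 2) : Prop where
  hasDegree : ∀ τ, #τ = k + 2 → HasDegree n k (b τ)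
  isCocycle : ∀ τ, #τ = k + 1 → IsCocycle n (c τ + ∑ v ∈ τᶜ, b (insert v τ))
  sum_supportCard_le : ∀ v, ∑ τ with #τ = k + 2 ∧ v ∈ τ, supportCard n (b τ) ≤ B

variable {n m K : ℕ} {c : Finset C → (Fin d → ℕ) → ZMod 2}

/-- The start of the descent: without rainbow simplices the cochains for `#τ = m + 1` are already
cocycles. -/
theorem IsColorCochain.isCorrection_zero (hc : IsColorCochain d n m K c) :
    IsCorrection n m 0 c 0 where
  hasDegree τ _ := HasDegree.zero n m
  isCocycle τ hτ F hF := by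
    simp only [Pi.zero_apply, sum_const_zero, add_zero]
    rw [hc.coboundary_eq τ (card_pos.1 (by omega)) hτ.le F hF]
    refine sum_eq_zero fun v hv => hc.eq_zero _ ?_ F hF
    rw [card_insert_of_notMem (mem_compl.1 hv), hτ]
  sum_supportCard_le v := by simp [supportCard_zero]

theorem IsCorrection.hasDegree_add {k B : ℕ} {b : Finset C → (Fin d → ℕ) → ZMod 2}
    (hc : IsColorCochain d n m K c) (hb : IsCorrection n k B c b) {τ : Finset C}
    (hτ : #τ = k + 1) : HasDegree n k (c τ + ∑ v ∈ τᶜ, b (insert v τ)) :=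
  (hc.hasDegree k τ hτ).add <| HasDegree.sum _ fun v hv => hb.hasDegree _ <| by
    rw [card_insert_of_notMem (mem_compl.1 hv), hτ]

theorem IsCorrection.sum_supportCard_add_le {k B : ℕ} {b : Finset C → (Fin d → ℕ) → ZMod 2}
    (hc : IsColorCochain d n m K c) (hb : IsCorrection n k B c b) (v : C) :
    ∑ τ with #τ = k + 1 ∧ v ∈ τ, supportCard n (c τ + ∑ w ∈ τᶜ, b (insert w τ)) ≤
      K + (k + 2) * B := by
  calc _ ≤ ∑ τ with #τ = k + 1 ∧ v ∈ τ,
        (supportCard n (c τ) + ∑ w ∈ τᶜ, supportCard n (b (insert w τ))) :=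
        sum_le_sum fun τ _ => (supportCard_add_le _ _ _).trans
          (Nat.add_le_add_left (supportCard_sum_le _ _ _) _)
    _ ≤ _ := by
        rw [sum_add_distrib]
        refine Nat.add_le_add ((sum_le_sum_of_subset ?_).trans (hc.sum_supportCard_le v)) ?_
        · intro τ
          simp only [mem_filter]
          exact fun h => ⟨h.1, h.2.2⟩
        · exact (sum_sum_insert_le v (k + 1) fun τ => supportCard n (b τ)).trans
            (Nat.mul_le_mul_left _ (hb.sum_supportCard_le v))

/-- Fill each corrected cocycle: `δ (b' σ) = c σ + ∑ b (insert w σ)` for `#σ = k + 2`. In `δ (c τ +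
∑ b' (insert v τ))` the terms `c (insert v τ)` then cancel, and the double sum of `b` left over
vanishes by symmetry. -/
theorem IsCorrection.exists_isCorrection {k B : ℕ} {b : Finset C → (Fin d → ℕ) → ZMod 2}
    (hc : IsColorCochain d n m K c) (hb : IsCorrection n (k + 1) B c b) (hk : k ≤ m) :
    ∃ b', IsCorrection n k (d * (n + 1) * (K + (k + 3) * B)) c b' := by
  have hfill : ∀ τ : Finset C, ∃ β : (Fin d → ℕ) → ZMod 2, #τ = k + 2 →
      (∀ F ∈ box d n, coboundary β F = (c τ + ∑ v ∈ τᶜ, b (insert v τ)) F) ∧ HasDegree n k β ∧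
      supportCard n β ≤ d * (n + 1) * supportCard n (c τ + ∑ v ∈ τᶜ, b (insert v τ)) := by
    intro τ
    by_cases hτ : #τ = k + 2
    · obtain ⟨β, hβ⟩ := (hb.isCocycle τ hτ).exists_filling (hb.hasDegree_add hc hτ)
      exact ⟨β, fun _ => hβ⟩
    · exact ⟨0, fun h => absurd h hτ⟩
  choose b' hb' using hfill
  refine ⟨b', ⟨fun τ hτ => (hb' τ hτ).2.1, fun τ hτ F hF => ?_, fun v => ?_⟩⟩
  · rw [coboundary_add, hc.coboundary_eq τ (card_pos.1 (by omega)) (by omega) F hF, coboundary_sum,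
      ← sum_add_distrib]
    have h1 : ∀ v ∈ τᶜ, c (insert v τ) F + coboundary (b' (insert v τ)) F =
        ∑ w ∈ (insert v τ)ᶜ, b (insert w (insert v τ)) F := by
      intro v hv
      rw [(hb' _ (by rw [card_insert_of_notMem (mem_compl.1 hv), hτ])).1 F hF, Pi.add_apply,
        Finset.sum_apply, ← add_assoc, CharTwo.add_self_eq_zero, zero_add]
    rw [sum_congr rfl h1]
    exact sum_sum_insert_insert_eq_zero τ fun σ => b σ F
  · calc _ ≤ ∑ τ with #τ = k + 2 ∧ v ∈ τ,
          d * (n + 1) * supportCard n (c τ + ∑ w ∈ τᶜ, b (insert w τ)) :=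
          sum_le_sum fun τ hτ => (hb' τ (mem_filter.1 hτ).2.1).2.2
      _ ≤ _ := by
          rw [← mul_sum]
          exact Nat.mul_le_mul_left _ (hb.sum_supportCard_add_le hc v)

/-- In the sum over all colors each `b {v, w}` occurs twice, so the augmentation stays `1` and some
corrected 0-cocycle is nonzero at `0`. -/
theorem IsCorrection.pow_le {B : ℕ} {b : Finset C → (Fin d → ℕ) → ZMod 2}
    (hc : IsColorCochain d n m K c) (hb : IsCorrection n 0 B c b) :
    (n + 1) ^ d ≤ K + 2 * B := by
  have hsum : ∑ v, (c {v} + ∑ w ∈ {v}ᶜ, b (insert w {v})) 0 = 1 := by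
    simp only [Pi.add_apply, Finset.sum_apply]
    rw [sum_add_distrib, hc.augmentation]
    have := sum_sum_insert_insert_eq_zero (∅ : Finset C) fun σ => b σ 0
    simp only [compl_empty, insert_empty_eq] at this
    rw [this, add_zero]
  obtain ⟨v, -, hv⟩ := exists_ne_zero_of_sum_ne_zero (hsum.trans_ne one_ne_zero)
  refine ((hb.isCocycle {v} (by simp)).le_supportCard (hb.hasDegree_add hc (by simp)) hv).trans ?_
  refine le_trans ?_ (hb.sum_supportCard_add_le hc v)
  exact single_le_sum (f := fun τ => supportCard n (c τ + ∑ w ∈ τᶜ, b (insert w τ)))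
    (fun _ _ => Nat.zero_le _) (by simp)

/-- The constants in the iterated filling inequality. -/
def fillingConst (d m : ℕ) : ℕ → ℕ
  | 0 => 0
  | j + 1 => 2 * d * (1 + (m + 2) * fillingConst d m j)

theorem IsColorCochain.exists_isCorrection (hc : IsColorCochain d n m K c) (hn : 0 < n) (j k : ℕ)
    (hjk : k + j = m) : ∃ b, IsCorrection n k (fillingConst d m j * n ^ j * K) c b := by
  induction j generalizing k with
  | zero =>
    obtain rfl : k = m := hjk
    exact ⟨0, by simpa [fillingConst] using hc.isCorrection_zero⟩
  | succ j ih =>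
    obtain ⟨b, hb⟩ := ih (k + 1) (by omega)
    obtain ⟨b', hb'⟩ := hb.exists_isCorrection hc (by omega)
    refine ⟨b', ⟨hb'.hasDegree, hb'.isCocycle, fun v => (hb'.sum_supportCard_le v).trans ?_⟩⟩
    have h1 : 1 ≤ n ^ j := Nat.one_le_pow _ _ hn
    -- The estimates are `n + 1 ≤ 2 * n`, `K ≤ n ^ j * K` and `k + 3 ≤ m + 2`.
    calc d * (n + 1) * (K + (k + 3) * (fillingConst d m j * n ^ j * K))
        ≤ d * (2 * n) * (n ^ j * K + (m + 2) * (fillingConst d m j * n ^ j * K)) := by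
          exact Nat.mul_le_mul (Nat.mul_le_mul_left _ (by omega)) (Nat.add_le_add
            (Nat.le_mul_of_pos_left K h1) (Nat.mul_le_mul_right _ (by omega)))
      _ = _ := by rw [fillingConst]; ring

theorem IsColorCochain.pow_le (hc : IsColorCochain d n m K c) (hn : 0 < n) :
    n ^ d ≤ (1 + 2 * fillingConst d m m) * n ^ m * K := by
  obtain ⟨b, hb⟩ := hc.exists_isCorrection hn m 0 (by omega)
  calc n ^ d ≤ (n + 1) ^ d := Nat.pow_le_pow_left (by omega) d
    _ ≤ 1 * K + 2 * (fillingConst d m m * n ^ m * K) := by simpa using hb.pow_le hc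
    _ ≤ n ^ m * K + 2 * (fillingConst d m m * n ^ m * K) := by
      gcongr
      exact Nat.one_le_pow _ _ hn
    _ = _ := by ring

end ColorCube

/-! ### Affine geometry near the barycenter of a simplex. -/

namespace ColorCube

open Finset Function Filter Topology

section Affine

variable {E : Type*} [AddCommGroup E] [Module ℝ E]

theorem eq_of_sum_smul_eq {s : Finset E} (hs : AffineIndependent ℝ ((↑) : s → E)) {w w' : E → ℝ}
    (h : ∑ p ∈ s, w p = ∑ p ∈ s, w' p) (h' : ∑ p ∈ s, w p • p = ∑ p ∈ s, w' p • p) :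
    ∀ p ∈ s, w p = w' p := by
  intro p hp
  have := affineIndependent_iff.1 hs univ (fun q => w q - w' q)
    (by rw [sum_sub_distrib, sub_eq_zero, sum_coe_sort s w, sum_coe_sort s w', h])
    (by
      simp only [sub_smul]
      rw [sum_sub_distrib, sub_eq_zero, sum_coe_sort s fun p => w p • p,
        sum_coe_sort s fun p => w' p • p, h']) ⟨p, hp⟩ (mem_univ _)
  exact sub_eq_zero.1 this

/-- The barycenter of a finite set of points. -/
noncomputable def barycenter (s : Finset E) : E := ∑ p ∈ s, (#s : ℝ)⁻¹ • p

theorem sum_inv_card {α : Type*} {s : Finset α} (hs : s.Nonempty) : ∑ _p ∈ s, (#s : ℝ)⁻¹ = 1 := by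
  have : (#s : ℝ) ≠ 0 := by simpa using hs.ne_empty
  rw [sum_const, nsmul_eq_mul, mul_inv_cancel₀ this]

theorem barycenter_mem_convexHull {s : Finset E} (hs : s.Nonempty) :
    barycenter s ∈ convexHull ℝ (s : Set E) :=
  Finset.mem_convexHull'.2 ⟨fun _ => (#s : ℝ)⁻¹, fun _ _ => by positivity, sum_inv_card hs, rfl⟩

/-- All barycentric coordinates of the barycenter are positive and they are unique, so no vertex can
be missing from `t`. -/
theorem subset_of_barycenter_mem_convexHull {s t : Finset E}
    (hs : AffineIndependent ℝ ((↑) : s → E)) (hne : s.Nonempty)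
    (h : barycenter s ∈ convexHull ℝ ((s : Set E) ∩ t)) : s ⊆ t := by
  classical
  rw [← coe_inter, Finset.mem_convexHull'] at h
  obtain ⟨w, -, hw1, hw⟩ := h
  intro p hp
  by_contra hpt
  have := eq_of_sum_smul_eq hs (w := fun _ => (#s : ℝ)⁻¹) (w' := fun q => if q ∈ t then w q else 0)
    (by rw [sum_inv_card hne, ← sum_filter, filter_mem_eq_inter, hw1])
    (by
      simp only [ite_smul, zero_smul]
      rw [← sum_filter, filter_mem_eq_inter, hw]
      rfl) p hp
  simp only [hpt, if_false, inv_eq_zero, Nat.cast_eq_zero, card_eq_zero] at this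
  exact hne.ne_empty this

theorem sub_mem_vectorSpan_of_mem_convexHull {s : Set E} {p q : E} (hp : p ∈ convexHull ℝ s)
    (hq : q ∈ convexHull ℝ s) : p - q ∈ vectorSpan ℝ s := by
  rw [← direction_affineSpan]
  exact AffineSubspace.vsub_mem_direction (convexHull_subset_affineSpan s hp)
    (convexHull_subset_affineSpan s hq)

/-- The barycenter is a relative interior point: positive weights absorb a small multiple of `p -
q`. Sums of directions are treated as midpoints of two perturbations of size `2 * δ`. -/
theorem eventually_barycenter_add_mem {s : Finset E} (hs : s.Nonempty) {u : E}
    (hu : u ∈ vectorSpan ℝ (s : Set E)) :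
    ∀ᶠ δ : ℝ in 𝓝 0, barycenter s + δ • u ∈ convexHull ℝ (s : Set E) := by
  classical
  have hpos : (0 : ℝ) < (#s : ℝ)⁻¹ := by
    have := hs.card_pos
    positivity
  rw [vectorSpan_def] at hu
  induction hu using Submodule.span_induction with
  | zero => simp [barycenter_mem_convexHull hs]
  | mem u hu =>
    obtain ⟨p, hp, q, hq, rfl⟩ := hu
    filter_upwards [Ioo_mem_nhds (neg_lt_zero.2 hpos) hpos] with δ hδ
    rw [Finset.mem_convexHull']
    refine ⟨fun r => (#s : ℝ)⁻¹ + ((if r = p then δ else 0) - if r = q then δ else 0),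
      fun r _ => ?_, ?_, ?_⟩
    · have := hδ.1
      have := hδ.2
      dsimp only
      split_ifs <;> linarith
    · rw [sum_add_distrib, sum_inv_card hs, sum_sub_distrib]
      simp [mem_coe.1 hp, mem_coe.1 hq]
    · simp only [add_smul, sub_smul, ite_smul, zero_smul]
      rw [sum_add_distrib, sum_sub_distrib]
      simp [mem_coe.1 hp, mem_coe.1 hq, barycenter, smul_sub]
  | add u v _ _ hu hv =>
    have ht : Tendsto (fun δ : ℝ => 2 * δ) (𝓝 0) (𝓝 0) := by
      have : Continuous fun δ : ℝ => 2 * δ := by fun_prop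
      simpa using this.tendsto 0
    filter_upwards [ht.eventually hu, ht.eventually hv] with δ h1 h2
    have h3 := convex_convexHull ℝ (s : Set E) h1 h2 (a := 1 / 2) (b := 1 / 2) (by norm_num)
      (by norm_num) (by norm_num)
    convert! h3 using 1
    module
  | smul c u _ hu =>
    have ht : Tendsto (fun δ : ℝ => δ * c) (𝓝 0) (𝓝 0) := by
      have : Continuous fun δ : ℝ => δ * c := by fun_prop
      simpa using this.tendsto 0
    filter_upwards [ht.eventually hu] with δ h1
    rwa [smul_smul]

/-- A point `w` on the side of the hyperplane spanned by `s` to which `v` points spans with `s` a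
simplex that contains the points near the barycenter of `s` in the direction `v`. -/
theorem eventually_barycenter_add_mem_insert {s : Finset E} (hs : s.Nonempty) {v w : E} {t : ℝ}
    (ht : 0 < t) (hw : w - barycenter s - t • v ∈ vectorSpan ℝ (s : Set E)) :
    ∀ᶠ ε : ℝ in 𝓝[>] 0, barycenter s + ε • v ∈ convexHull ℝ (insert w (s : Set E)) := by
  set x := barycenter s
  have hc : Tendsto (fun ε : ℝ => -((ε / t) / (1 - ε / t))) (𝓝 0) (𝓝 0) := by
    have : ContinuousAt (fun ε : ℝ => -((ε / t) / (1 - ε / t))) 0 := by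
      refine ContinuousAt.neg (ContinuousAt.div (by fun_prop) (by fun_prop) (by simp))
    simpa [ContinuousAt] using this
  have h1 := nhdsWithin_le_nhds (s := Set.Ioi 0)
    (hc.eventually (eventually_barycenter_add_mem hs hw))
  filter_upwards [h1, self_mem_nhdsWithin, nhdsWithin_le_nhds (Iio_mem_nhds ht)] with ε h1 h2 h3
  have h2 : 0 < ε := h2
  have h3 : ε / t < 1 := (div_lt_one ht).2 h3
  have h4 : (1 - ε / t) ≠ 0 := by linarith
  -- With `u = w - x - t • v`, the point `x + ε • v` is the combination of `w` and `x - ((ε / t) /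
  -- (1 - ε / t)) • u` with weights `ε / t` and `1 - ε / t`; the second point is in the hull of `s`
  -- for small `ε`.
  have h5 := convex_convexHull ℝ (insert w (s : Set E))
    (subset_convexHull ℝ _ (Set.mem_insert w _)) (convexHull_mono (Set.subset_insert w _) h1)
    (a := ε / t) (b := 1 - ε / t) (by positivity) (by linarith) (by ring)
  convert! h5 using 1
  rw [smul_add, smul_smul, mul_neg, mul_div_cancel₀ _ h4]
  have h6 : ε = (ε / t) * t := by field_simp
  nth_rw 1 [h6]
  module

theorem not_mem_affineSpan_of_insert [DecidableEq E] {s : Finset E} {w : E} (hw : w ∉ s)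
    (h : AffineIndependent ℝ ((↑) : ↥(insert w s) → E)) :
    w ∉ affineSpan ℝ (s : Set E) := by
  have h1 := h.notMem_affineSpan_sdiff ⟨w, mem_insert_self w s⟩ Set.univ
  have h2 : ((↑) : ↥(insert w s) → E) '' (Set.univ \ {⟨w, mem_insert_self w s⟩}) =
      (s : Set E) := by
    ext p
    constructor
    · rintro ⟨⟨q, hq⟩, ⟨-, h1⟩, rfl⟩
      exact (mem_insert.1 hq).resolve_left fun h => h1 (Subtype.ext h)
    · intro hp
      refine ⟨⟨p, mem_insert_of_mem hp⟩, ⟨trivial, fun h => hw ?_⟩, rfl⟩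
      have hpw : p = w := Subtype.ext_iff.1 h
      exact hpw ▸ hp
  rwa [h2] at h1

end Affine

/-! ### Cells as convex sets and their directions. -/

section Cell

variable {d : ℕ}

/-- The cell with doubled barycenter `F`, as a set of points. -/
def cubeSet (F : Fin d → ℕ) : Set (Fin d → ℝ) :=
  {x | ∀ i, ((F i / 2 : ℕ) : ℝ) ≤ x i ∧ x i ≤ (((F i + 1) / 2 : ℕ) : ℝ)}

/-- The directions parallel to a cell. -/
def cellDirection (F : Fin d → ℕ) : Submodule ℝ (Fin d → ℝ) :=
  LinearMap.ker (LinearMap.funLeft ℝ ℝ (Subtype.val : {i // ¬ Odd (F i)} → Fin d))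

theorem mem_cellDirection {F : Fin d → ℕ} {v : Fin d → ℝ} :
    v ∈ cellDirection F ↔ ∀ i, ¬ Odd (F i) → v i = 0 := by
  rw [cellDirection, LinearMap.mem_ker, funext_iff]
  simp [LinearMap.funLeft_apply]

theorem finrank_cellDirection (F : Fin d → ℕ) :
    Module.finrank ℝ (cellDirection F) = cellDim F := by
  have h1 := LinearMap.finrank_range_add_finrank_ker
    (LinearMap.funLeft ℝ ℝ (Subtype.val : {i // ¬ Odd (F i)} → Fin d))
  rw [LinearMap.range_eq_top.2 (LinearMap.funLeft_surjective_of_injective ℝ ℝ _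
    Subtype.val_injective), finrank_top, Module.finrank_fintype_fun_eq_card,
    Module.finrank_fintype_fun_eq_card, Fintype.card_subtype, Fintype.card_fin] at h1
  have h2 := card_filter_add_card_filter_not (s := (univ : Finset (Fin d))) (fun i => Odd (F i))
  rw [card_univ, Fintype.card_fin] at h2
  rw [cellDirection, cellDim]
  omega

theorem convex_cubeSet (F : Fin d → ℕ) : Convex ℝ (cubeSet F) := by
  have : cubeSet F = Set.Icc (fun i => ((F i / 2 : ℕ) : ℝ))
      (fun i => (((F i + 1) / 2 : ℕ) : ℝ)) := by
    ext x
    simp only [cubeSet, Set.mem_ofPred_eq, Set.mem_Icc, Pi.le_def, forall_and]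
  rw [this]
  exact convex_Icc _ _

theorem sub_mem_cellDirection {F : Fin d → ℕ} {x y : Fin d → ℝ} (hx : x ∈ cubeSet F)
    (hy : y ∈ cubeSet F) : x - y ∈ cellDirection F := by
  rw [mem_cellDirection]
  intro i hi
  rw [Nat.not_odd_iff_even] at hi
  obtain ⟨a, ha⟩ := hi
  have h1 := hx i
  have h2 := hy i
  rw [show (F i + 1) / 2 = F i / 2 by omega] at h1 h2
  simp only [Pi.sub_apply]
  linarith [h1.1, h1.2, h2.1, h2.2]

theorem vectorSpan_le_cellDirection {F : Fin d → ℕ} {s : Set (Fin d → ℝ)} (hs : s ⊆ cubeSet F) :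
    vectorSpan ℝ s ≤ cellDirection F := by
  rw [vectorSpan_def, Submodule.span_le]
  rintro _ ⟨p, hp, q, hq, rfl⟩
  exact sub_mem_cellDirection (hs hp) (hs hq)

theorem card_le_cellDim {F : Fin d → ℕ} {s : Finset (Fin d → ℝ)}
    (hs : AffineIndependent ℝ ((↑) : s → Fin d → ℝ)) (hF : (s : Set (Fin d → ℝ)) ⊆ cubeSet F) :
    #s ≤ cellDim F + 1 := by
  have h1 := hs.card_le_finrank_succ
  rw [Subtype.range_coe_subtype, Fintype.card_coe] at h1
  refine h1.trans (Nat.add_le_add_right ?_ 1)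
  rw [← finrank_cellDirection]
  exact Submodule.finrank_mono (vectorSpan_le_cellDirection hF)

theorem isCubicalFace_iff {n k : ℕ} {S : Set (Fin d → ℝ)} :
    IsCubicalFace d n k S ↔ ∃ F ∈ box d n, cellDim F = k ∧ S = cubeSet F := by
  constructor
  · rintro ⟨a, I, h, hI, rfl⟩
    refine ⟨fun i => 2 * a i + if i ∈ I then 1 else 0, mem_box.2 fun i => ?_, ?_, ?_⟩
    · have := h i
      split_ifs at * <;> omega
    · rw [← hI, cellDim]
      congr 1
      ext i
      by_cases hi : i ∈ I <;> simp [hi]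
    · ext x
      refine forall_congr' fun i => ?_
      dsimp only
      split_ifs
      · rw [show (2 * a i + 1) / 2 = a i by omega, show (2 * a i + 1 + 1) / 2 = a i + 1 by omega]
        simp
      · rw [show (2 * a i + 0) / 2 = a i by omega, show (2 * a i + 0 + 1) / 2 = a i by omega]
        simp
  · rintro ⟨F, hF, hk, rfl⟩
    refine ⟨fun i => F i / 2, ({i | Odd (F i)} : Finset (Fin d)), fun i => ?_, hk, ?_⟩
    · have := mem_box.1 hF i
      by_cases ho : Odd (F i)
      · have ho' := ho
        obtain ⟨a, ha⟩ := ho'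
        simp only [mem_filter, mem_univ, true_and, ho, if_true]
        omega
      · simp only [mem_filter, mem_univ, true_and, ho, if_false]
        omega
    · ext x
      refine forall_congr' fun i => ?_
      by_cases ho : Odd (F i)
      · have ho' := ho
        obtain ⟨a, ha⟩ := ho'
        simp only [mem_filter, mem_univ, true_and, ho, if_true]
        rw [show (F i + 1) / 2 = F i / 2 + 1 by omega, Nat.cast_succ]
      · have ho' := ho
        obtain ⟨a, ha⟩ := Nat.not_odd_iff_even.1 ho'
        simp only [mem_filter, mem_univ, true_and, ho, if_false, add_zero]
        rw [show (F i + 1) / 2 = F i / 2 by omega]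

end Cell

end ColorCube

/-! ### Simplices on the two sides of a codimension one simplex. -/

namespace ColorCube

open Finset Function Filter Topology

variable {d n r : ℕ} {T : Geometry.SimplicialComplex ℝ (Fin d → ℝ)}

/-- The lattice points of the cube as a finite set. -/
noncomputable def latticeFinset (d n : ℕ) : Finset (Fin d → ℝ) :=
  (Fintype.piFinset fun _ : Fin d => range (n + 1)).image fun a i => (a i : ℝ)

theorem coe_latticeFinset (d n : ℕ) : (latticeFinset d n : Set (Fin d → ℝ)) = latticePoints d n := by
  ext x
  simp only [latticeFinset, latticePoints, mem_coe, mem_image, Fintype.mem_piFinset, mem_range,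
    Nat.lt_succ_iff, Set.mem_ofPred_eq, eq_comm (a := x)]

namespace IsSkeletonTriangulation

variable (hT : IsSkeletonTriangulation d n r T)
include hT

theorem subset_latticeFinset {σ : Finset (Fin d → ℝ)} (hσ : σ ∈ T.faces) :
    σ ⊆ latticeFinset d n := by
  intro p hp
  rw [← mem_coe, coe_latticeFinset, ← hT.vertices_eq]
  exact T.down_closed hσ (singleton_subset_iff.2 hp) (singleton_nonempty p)

theorem finite_faces : T.faces.Finite :=
  (latticeFinset d n).powerset.finite_toSet.subset fun _ hσ =>
    mem_coe.2 (mem_powerset.2 (hT.subset_latticeFinset hσ))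

end IsSkeletonTriangulation

theorem eq_of_le_sum_mul {α : Type*} {s : Finset α} {w a : α → ℝ} {b : ℝ} (hw : ∀ p ∈ s, 0 ≤ w p)
    (hw1 : ∑ p ∈ s, w p = 1) (ha : ∀ p ∈ s, a p ≤ b) (hb : b ≤ ∑ p ∈ s, w p * a p) {p : α}
    (hp : p ∈ s) (hwp : w p ≠ 0) : a p = b := by
  have h1 : ∑ p ∈ s, w p * (b - a p) = 0 := by
    refine le_antisymm ?_ (sum_nonneg fun q hq => mul_nonneg (hw q hq) (sub_nonneg.2 (ha q hq)))
    simp only [mul_sub]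
    rw [sum_sub_distrib, ← sum_mul, hw1]
    linarith
  have h2 := (sum_eq_zero_iff_of_nonneg fun q hq =>
    mul_nonneg (hw q hq) (sub_nonneg.2 (ha q hq))).1 h1 p hp
  rcases mul_eq_zero.1 h2 with h | h
  · exact absurd h hwp
  · linarith

/-- The intersection of two cells of the grid is a face of either of them. -/
theorem mem_cubeSet_of_sum_mem {F G : Fin d → ℕ} {σ : Finset (Fin d → ℝ)} {w : (Fin d → ℝ) → ℝ}
    (hσ : (σ : Set (Fin d → ℝ)) ⊆ cubeSet G) (hw : ∀ p ∈ σ, 0 ≤ w p) (hw1 : ∑ p ∈ σ, w p = 1)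
    (hF : ∑ p ∈ σ, w p • p ∈ cubeSet F) {p : Fin d → ℝ} (hp : p ∈ σ) (hwp : w p ≠ 0) :
    p ∈ cubeSet F := by
  intro i
  have hFi := hF i
  simp only [Finset.sum_apply, Pi.smul_apply, smul_eq_mul] at hFi
  constructor
  · by_cases h : F i / 2 ≤ G i / 2
    · exact (Nat.cast_le.2 h).trans (hσ hp i).1
    -- Here `G` lies weakly below the lower wall of `F`, so a convex combination that reaches the
    -- wall has all its weight on the wall.
    · refine (eq_of_le_sum_mul hw hw1 (a := fun q => q i) (fun q hq => (hσ hq i).2.trans ?_)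
        hFi.1 hp hwp).ge
      exact Nat.cast_le.2 (by omega)
  · by_cases h : (G i + 1) / 2 ≤ (F i + 1) / 2
    · exact (hσ hp i).2.trans (Nat.cast_le.2 h)
    · have h1 := eq_of_le_sum_mul hw hw1 (a := fun q => -q i) (b := -(((F i + 1) / 2 : ℕ) : ℝ))
        (fun q hq => neg_le_neg ((hσ hq i).1.trans' ?_)) ?_ hp hwp
      · exact (neg_inj.1 h1).le
      · exact Nat.cast_le.2 (by omega)
      · simp only [mul_neg, sum_neg_distrib]
        exact neg_le_neg hFi.2

namespace IsSkeletonTriangulation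

variable (hT : IsSkeletonTriangulation d n r T)
include hT

/-- A cell is covered by the simplices of the triangulation that it contains. -/
theorem exists_face_of_mem_cubeSet {F : Fin d → ℕ} (hF : F ∈ box d n) (hd : cellDim F ≤ r)
    {y : Fin d → ℝ} (hy : y ∈ cubeSet F) :
    ∃ σ ∈ T.faces, (σ : Set (Fin d → ℝ)) ⊆ cubeSet F ∧ y ∈ convexHull ℝ (σ : Set (Fin d → ℝ)) := by
  classical
  have h1 : y ∈ T.space := by
    rw [hT.space_eq]
    exact ⟨cellDim F, hd, cubeSet F, isCubicalFace_iff.2 ⟨F, hF, rfl, rfl⟩, hy⟩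
  obtain ⟨σ, hσ, hyσ⟩ := T.mem_space_iff.1 h1
  obtain ⟨j, -, S, hS, hσS⟩ := hT.subdivides σ hσ
  obtain ⟨G, -, -, rfl⟩ := isCubicalFace_iff.1 hS
  obtain ⟨w, hw, hw1, rfl⟩ := Finset.mem_convexHull'.1 hyσ
  -- A simplex containing `y` need not lie in the cell, but its vertices off the cell have weight
  -- zero at `y` and can be dropped.
  have h2 : ∀ p ∈ σ, p ∉ σ.filter (· ∈ cubeSet F) → w p = 0 := by
    intro p hp hpF
    by_contra hwp
    exact hpF (mem_filter.2 ⟨hp, mem_cubeSet_of_sum_mem ((subset_convexHull ℝ _).trans hσS)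
      hw hw1 hy hp hwp⟩)
  have h3 : ∑ p ∈ σ with p ∈ cubeSet F, w p = 1 := by
    rw [sum_subset (filter_subset _ _) h2, hw1]
  refine ⟨σ.filter (· ∈ cubeSet F), T.down_closed hσ (filter_subset _ _) ?_, ?_, ?_⟩
  · by_contra hne
    rw [not_nonempty_iff_eq_empty.1 hne, sum_empty] at h3
    exact zero_ne_one h3
  · intro p hp
    exact (mem_filter.1 (mem_coe.1 hp)).2
  · refine Finset.mem_convexHull'.2 ⟨w, fun p hp => hw p (mem_filter.1 hp).1, h3, ?_⟩
    exact sum_subset (filter_subset _ _) fun p hp hpF => by rw [h2 p hp hpF, zero_smul]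

/-- On each side of a codimension one simplex `ρ` of a cell there is a simplex. -/
theorem exists_coface {F : Fin d → ℕ} (hF : F ∈ box d n) (hd : cellDim F ≤ r)
    {ρ : Finset (Fin d → ℝ)} (hρ : ρ ∈ T.faces) (hcard : #ρ = cellDim F) {v : Fin d → ℝ}
    (hv : v ∉ vectorSpan ℝ (ρ : Set (Fin d → ℝ)))
    (hvF : ∀ᶠ ε : ℝ in 𝓝[>] 0, barycenter ρ + ε • v ∈ cubeSet F) :
    ∃ w ∉ ρ, insert w ρ ∈ T.faces ∧ w ∈ cubeSet F ∧
      ∃ t : ℝ, 0 < t ∧ w - barycenter ρ - t • v ∈ vectorSpan ℝ (ρ : Set (Fin d → ℝ)) := by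
  classical
  have hne := T.nonempty_of_mem_faces hρ
  set x := barycenter ρ with hx
  -- There are finitely many simplices, so a single one contains `x + ε • v` for arbitrarily small
  -- `ε`; being closed, it contains `x`, and hence `ρ` is a face of it.
  obtain ⟨σ, ⟨hσ, hσF⟩, hfreq⟩ : ∃ σ ∈ {σ | σ ∈ T.faces ∧ (σ : Set (Fin d → ℝ)) ⊆ cubeSet F},
      ∃ᶠ ε : ℝ in 𝓝[>] 0, x + ε • v ∈ convexHull ℝ (σ : Set (Fin d → ℝ)) := by
    by_contra! hc
    have h1 := (eventually_all_finite (hT.finite_faces.subset fun σ hσ => hσ.1)).2 hc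
    obtain ⟨ε, h2, h3⟩ := (h1.and hvF).exists
    obtain ⟨σ, hσ, hσF, hy⟩ := hT.exists_face_of_mem_cubeSet hF hd h3
    exact h2 σ ⟨hσ, hσF⟩ hy
  have hxσ : x ∈ convexHull ℝ (σ : Set (Fin d → ℝ)) := by
    refine (Set.Finite.isClosed_convexHull ℝ σ.finite_toSet).mem_of_frequently_of_tendsto hfreq ?_
    have : Continuous fun ε : ℝ => x + ε • v := by fun_prop
    have := (this.tendsto 0).mono_left (nhdsWithin_le_nhds (s := Set.Ioi 0))
    simpa using this
  have hρσ : ρ ⊆ σ := subset_of_barycenter_mem_convexHull (T.indep hρ) hne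
    (T.inter_subset_convexHull hρ hσ ⟨barycenter_mem_convexHull hne, hxσ⟩)
  obtain ⟨ε, hε, hε0⟩ := (hfreq.and_eventually self_mem_nhdsWithin).exists
  have hε0 : 0 < ε := hε0
  have hneσ : ρ ≠ σ := by
    rintro rfl
    refine hv ((Submodule.smul_mem_iff _ hε0.ne').1 ?_)
    simpa [hx] using sub_mem_vectorSpan_of_mem_convexHull hε (barycenter_mem_convexHull hne)
  obtain ⟨w, hw, hwρ⟩ := exists_of_ssubset (hρσ.ssubset_of_ne hneσ)
  have hσ' : insert w ρ = σ := by
    refine eq_of_subset_of_card_le (insert_subset hw hρσ) ?_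
    rw [card_insert_of_notMem hwρ, hcard]
    exact card_le_cellDim (T.indep hσ) hσF
  refine ⟨w, hwρ, hσ' ▸ hσ, hσF hw, ?_⟩
  rw [← hσ', coe_insert, convexHull_insert (by simpa using hne), mem_convexJoin] at hε
  obtain ⟨u, hu, q, hq, a, b, ha, hb, hab, he⟩ := hε
  rw [Set.mem_singleton_iff.1 hu] at he
  have hqx := sub_mem_vectorSpan_of_mem_convexHull hq (barycenter_mem_convexHull hne)
  rw [← hx] at hqx
  have h1 : a • (w - x) - ε • v ∈ vectorSpan ℝ (ρ : Set (Fin d → ℝ)) := by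
    have h2 : a • (w - x) - ε • v = -(b • (q - x)) := by
      obtain rfl : b = 1 - a := by linarith
      have h3 : ε • v = a • w + (1 - a) • q - x := by rw [he]; abel
      rw [h3]
      module
    rw [h2]
    exact neg_mem (Submodule.smul_mem _ _ hqx)
  have ha0 : 0 < a := by
    refine lt_of_le_of_ne ha fun h => hv ?_
    rw [← h, zero_smul, zero_sub, neg_mem_iff, Submodule.smul_mem_iff _ hε0.ne'] at h1
    exact h1
  refine ⟨ε / a, by positivity, ?_⟩
  rw [← Submodule.smul_mem_iff _ ha0.ne']
  convert! h1 using 1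
  rw [smul_sub, smul_smul, mul_div_cancel₀ _ ha0.ne']

omit hT in
/-- On each side of a codimension one simplex `ρ` of a cell there is at most one simplex. -/
theorem coface_unique {ρ : Finset (Fin d → ℝ)} (hρ : ρ ∈ T.faces) {v w w' : Fin d → ℝ}
    (hv : v ∉ vectorSpan ℝ (ρ : Set (Fin d → ℝ))) (hw : w ∉ ρ) (hw' : w' ∉ ρ)
    (hT1 : insert w ρ ∈ T.faces) (hT2 : insert w' ρ ∈ T.faces) {t t' : ℝ} (ht : 0 < t)
    (ht' : 0 < t') (h1 : w - barycenter ρ - t • v ∈ vectorSpan ℝ (ρ : Set (Fin d → ℝ)))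
    (h2 : w' - barycenter ρ - t' • v ∈ vectorSpan ℝ (ρ : Set (Fin d → ℝ))) : w = w' := by
  by_contra hne
  have hn := T.nonempty_of_mem_faces hρ
  obtain ⟨ε, ⟨h3, h4⟩, h5⟩ := (((eventually_barycenter_add_mem_insert hn ht h1).and
    (eventually_barycenter_add_mem_insert hn ht' h2)).and self_mem_nhdsWithin).exists
  have h5 : 0 < ε := h5
  rw [← coe_insert] at h3 h4
  -- Both simplices contain `x + ε • v`, with `x` the barycenter, which is off the affine span of
  -- `ρ`, whereas they may meet only in the hull of `ρ`.
  have h6 := T.inter_subset_convexHull hT1 hT2 ⟨h3, h4⟩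
  rw [← coe_inter, show insert w ρ ∩ insert w' ρ = ρ by
    ext p
    simp only [mem_inter, mem_insert]
    constructor
    · rintro ⟨rfl | h, rfl | h'⟩
      · exact absurd rfl hne
      · exact h'
      · exact h
      · exact h
    · exact fun h => ⟨Or.inr h, Or.inr h⟩] at h6
  refine hv ((Submodule.smul_mem_iff _ h5.ne').1 ?_)
  simpa using sub_mem_vectorSpan_of_mem_convexHull h6 (barycenter_mem_convexHull hn)

end IsSkeletonTriangulation

end ColorCube

/-! ### Parity of the number of cofaces in a cell. -/

namespace ColorCube

open Finset Function Filter Topology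

variable {d n r : ℕ} {T : Geometry.SimplicialComplex ℝ (Fin d → ℝ)}

theorem mem_cubeSet_update {F : Fin d → ℕ} {i : Fin d} {e a : ℕ} (he : e = 2 * a)
    (h1 : F i / 2 ≤ a) (h2 : a ≤ (F i + 1) / 2) {x : Fin d → ℝ} :
    x ∈ cubeSet (update F i e) ↔ x ∈ cubeSet F ∧ x i = a := by
  have hd : e / 2 = a := by omega
  have hd' : (e + 1) / 2 = a := by omega
  constructor
  · intro h
    have hi := h i
    rw [update_self, hd, hd'] at hi
    have hi : x i = a := le_antisymm hi.2 hi.1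
    refine ⟨fun j => ?_, hi⟩
    rcases eq_or_ne j i with rfl | hj
    · rw [hi]
      exact ⟨Nat.cast_le.2 h1, Nat.cast_le.2 h2⟩
    · simpa [hj] using h j
  · rintro ⟨h, hi⟩ j
    rcases eq_or_ne j i with rfl | hj
    · rw [update_self, hd, hd', hi]
      exact ⟨le_rfl, le_rfl⟩
    · simpa [hj] using h j

theorem mem_cubeSet_lower {F : Fin d → ℕ} {i : Fin d} (hi : Odd (F i)) {x : Fin d → ℝ} :
    x ∈ cubeSet (update F i (F i - 1)) ↔ x ∈ cubeSet F ∧ x i = (F i / 2 : ℕ) := by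
  obtain ⟨a, ha⟩ := hi
  exact mem_cubeSet_update (by omega) (by omega) (by omega)

theorem mem_cubeSet_upper {F : Fin d → ℕ} {i : Fin d} (hi : Odd (F i)) {x : Fin d → ℝ} :
    x ∈ cubeSet (update F i (F i + 1)) ↔ x ∈ cubeSet F ∧ x i = ((F i + 1) / 2 : ℕ) := by
  obtain ⟨a, ha⟩ := hi
  exact mem_cubeSet_update (by omega) (by omega) (by omega)

/-- The simplex `ρ` and the point `w` of the cell `F` span a simplex of `T`. -/
def IsCoface (T : Geometry.SimplicialComplex ℝ (Fin d → ℝ)) (F : Fin d → ℕ)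
    (ρ : Finset (Fin d → ℝ)) (w : Fin d → ℝ) : Prop :=
  w ∉ ρ ∧ insert w ρ ∈ T.faces ∧ w ∈ cubeSet F

section

variable {F : Fin d → ℕ} {ρ : Finset (Fin d → ℝ)}

theorem finrank_vectorSpan_add_one (hρ : AffineIndependent ℝ ((↑) : ρ → Fin d → ℝ))
    (hne : ρ.Nonempty) (hcard : #ρ = cellDim F) :
    Module.finrank ℝ (vectorSpan ℝ (ρ : Set (Fin d → ℝ))) + 1 =
      Module.finrank ℝ (cellDirection F) := by
  have h0 := hne.card_pos
  have h1 := hρ.finrank_vectorSpan (n := #ρ - 1) (by rw [Fintype.card_coe]; omega)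
  rw [Subtype.range_coe_subtype] at h1
  rw [finrank_cellDirection, ← hcard]
  change Module.finrank ℝ (vectorSpan ℝ {p | p ∈ ρ}) + 1 = _
  omega

/-- The directions of `ρ` form a hyperplane in those of the cell, and `v` is off it. The sign of `t`
will tell the side of `ρ`. -/
theorem exists_sub_smul_mem_vectorSpan (hρ : AffineIndependent ℝ ((↑) : ρ → Fin d → ℝ))
    (hne : ρ.Nonempty) (hcard : #ρ = cellDim F) (hρF : (ρ : Set (Fin d → ℝ)) ⊆ cubeSet F)
    {v : Fin d → ℝ} (hvF : v ∈ cellDirection F) (hv : v ∉ vectorSpan ℝ (ρ : Set (Fin d → ℝ)))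
    {u : Fin d → ℝ} (hu : u ∈ cellDirection F) :
    ∃ t : ℝ, u - t • v ∈ vectorSpan ℝ (ρ : Set (Fin d → ℝ)) := by
  set V := vectorSpan ℝ (ρ : Set (Fin d → ℝ)) with hV
  have hrank := finrank_vectorSpan_add_one hρ hne hcard
  have hlt : V < V ⊔ Submodule.span ℝ {v} := by
    refine lt_of_le_of_ne le_sup_left fun h => hv ?_
    rw [h]
    exact Submodule.mem_sup_right (Submodule.mem_span_singleton_self v)
  have hle : V ⊔ Submodule.span ℝ {v} ≤ cellDirection F :=
    sup_le (vectorSpan_le_cellDirection hρF) ((Submodule.span_singleton_le_iff_mem v _).2 hvF)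
  have heq := Submodule.eq_of_le_of_finrank_le hle (by
    have := Submodule.finrank_lt_finrank_of_lt hlt
    rw [← hV] at hrank
    omega)
  rw [← heq, Submodule.mem_sup] at hu
  obtain ⟨y, hy, z, hz, rfl⟩ := hu
  obtain ⟨t, rfl⟩ := Submodule.mem_span_singleton.1 hz
  exact ⟨t, by simpa using hy⟩

theorem barycenter_mem_cubeSet (hne : ρ.Nonempty) (hρF : (ρ : Set (Fin d → ℝ)) ⊆ cubeSet F) :
    barycenter ρ ∈ cubeSet F :=
  convexHull_min hρF (convex_cubeSet F) (barycenter_mem_convexHull hne)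

/-- If `t` were zero, `u` would lie in the affine span of `ρ`, against affine independence. -/
theorem IsCoface.exists_ne_zero (hρ : ρ ∈ T.faces) (hcard : #ρ = cellDim F)
    (hρF : (ρ : Set (Fin d → ℝ)) ⊆ cubeSet F) {v : Fin d → ℝ} (hvF : v ∈ cellDirection F)
    (hv : v ∉ vectorSpan ℝ (ρ : Set (Fin d → ℝ))) {u : Fin d → ℝ} (hu : IsCoface T F ρ u) :
    ∃ t : ℝ, t ≠ 0 ∧ u - barycenter ρ - t • v ∈ vectorSpan ℝ (ρ : Set (Fin d → ℝ)) := by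
  have hne := T.nonempty_of_mem_faces hρ
  obtain ⟨t, ht⟩ := exists_sub_smul_mem_vectorSpan (T.indep hρ) hne hcard hρF hvF hv
    (sub_mem_cellDirection hu.2.2 (barycenter_mem_cubeSet hne hρF))
  refine ⟨t, ?_, ht⟩
  rintro rfl
  rw [zero_smul, sub_zero, ← direction_affineSpan] at ht
  refine not_mem_affineSpan_of_insert hu.1 (T.indep hu.2.1) ?_
  have h1 := convexHull_subset_affineSpan _ (barycenter_mem_convexHull hne)
  have h2 := AffineSubspace.vadd_mem_of_mem_direction ht h1
  simpa using h2

theorem lt_barycenter_apply {i : Fin d} {a : ℝ} (h : ∀ p ∈ ρ, a ≤ p i) (h' : ∃ p ∈ ρ, p i ≠ a) :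
    a < barycenter ρ i := by
  obtain ⟨p, hp, hpa⟩ := h'
  have hne : ρ.Nonempty := ⟨p, hp⟩
  have hpos : (0 : ℝ) < (#ρ : ℝ)⁻¹ := by
    have := hne.card_pos
    positivity
  calc a = ∑ _p ∈ ρ, (#ρ : ℝ)⁻¹ * a := by rw [← sum_mul, sum_inv_card hne, one_mul]
    _ < ∑ p ∈ ρ, (#ρ : ℝ)⁻¹ * p i :=
        sum_lt_sum (fun q hq => mul_le_mul_of_nonneg_left (h q hq) hpos.le)
          ⟨p, hp, mul_lt_mul_of_pos_left (lt_of_le_of_ne (h p hp) hpa.symm) hpos⟩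
    _ = _ := by simp [barycenter]

theorem barycenter_apply_lt {i : Fin d} {a : ℝ} (h : ∀ p ∈ ρ, p i ≤ a) (h' : ∃ p ∈ ρ, p i ≠ a) :
    barycenter ρ i < a := by
  obtain ⟨p, hp, hpa⟩ := h'
  have hne : ρ.Nonempty := ⟨p, hp⟩
  have hpos : (0 : ℝ) < (#ρ : ℝ)⁻¹ := by
    have := hne.card_pos
    positivity
  calc barycenter ρ i = ∑ p ∈ ρ, (#ρ : ℝ)⁻¹ * p i := by simp [barycenter]
    _ < ∑ _p ∈ ρ, (#ρ : ℝ)⁻¹ * a :=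
        sum_lt_sum (fun q hq => mul_le_mul_of_nonneg_left (h q hq) hpos.le)
          ⟨p, hp, mul_lt_mul_of_pos_left (lt_of_le_of_ne (h p hp) hpa) hpos⟩
    _ = a := by rw [← sum_mul, sum_inv_card hne, one_mul]

end

namespace IsSkeletonTriangulation

variable {F : Fin d → ℕ} {ρ : Finset (Fin d → ℝ)}

/-- A codimension one simplex in the interior of a cell has exactly two cofaces in it. -/
theorem exists_cofaces_of_interior (hT : IsSkeletonTriangulation d n r T) (hF : F ∈ box d n)
    (hd : cellDim F ≤ r) (hρ : ρ ∈ T.faces) (hcard : #ρ = cellDim F)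
    (hρF : (ρ : Set (Fin d → ℝ)) ⊆ cubeSet F)
    (hint : ∀ i, Odd (F i) → ¬ (ρ : Set (Fin d → ℝ)) ⊆ cubeSet (update F i (F i - 1)) ∧
      ¬ (ρ : Set (Fin d → ℝ)) ⊆ cubeSet (update F i (F i + 1))) :
    ∃ w w', w ≠ w' ∧ ∀ u, IsCoface T F ρ u ↔ u = w ∨ u = w' := by
  have hne := T.nonempty_of_mem_faces hρ
  have hlt : vectorSpan ℝ (ρ : Set (Fin d → ℝ)) < cellDirection F := by
    refine lt_of_le_of_ne (vectorSpan_le_cellDirection hρF) fun h => ?_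
    have := finrank_vectorSpan_add_one (T.indep hρ) hne hcard
    rw [h] at this
    omega
  obtain ⟨v, hvF, hv⟩ := SetLike.exists_of_lt hlt
  -- Since `ρ` lies in no facet, its barycenter is strictly between the walls in each direction of
  -- the cell, so one may move both ways.
  have hin : ∀ v ∈ cellDirection F, ∀ᶠ ε : ℝ in 𝓝[>] 0, barycenter ρ + ε • v ∈ cubeSet F := by
    intro v hvF
    refine nhdsWithin_le_nhds ?_
    change ∀ᶠ ε : ℝ in 𝓝 0, ∀ i, _
    rw [eventually_all]
    intro i
    by_cases hi : Odd (F i)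
    · obtain ⟨h1, h2⟩ := hint i hi
      rw [Set.not_subset] at h1 h2
      obtain ⟨p, hp, hpi⟩ := h1
      obtain ⟨q, hq, hqi⟩ := h2
      rw [mem_cubeSet_lower hi] at hpi
      rw [mem_cubeSet_upper hi] at hqi
      have h3 := lt_barycenter_apply (fun p hp => (hρF hp i).1)
        ⟨p, hp, fun h => hpi ⟨hρF hp, h⟩⟩
      have h4 := barycenter_apply_lt (fun p hp => (hρF hp i).2)
        ⟨q, hq, fun h => hqi ⟨hρF hq, h⟩⟩
      have hc : Continuous fun ε : ℝ => (barycenter ρ + ε • v) i := by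
        simp only [Pi.add_apply, Pi.smul_apply]
        fun_prop
      have hc0 : Tendsto (fun ε : ℝ => (barycenter ρ + ε • v) i) (𝓝 0) (𝓝 (barycenter ρ i)) := by
        simpa using hc.tendsto 0
      have h5 := hc0.eventually (Ioo_mem_nhds h3 h4)
      exact h5.mono fun ε h => ⟨h.1.le, h.2.le⟩
    · refine Eventually.of_forall fun ε => ?_
      rw [Pi.add_apply, Pi.smul_apply, mem_cellDirection.1 hvF i hi, smul_zero, add_zero]
      exact barycenter_mem_cubeSet hne hρF i
  have hv' : -v ∉ vectorSpan ℝ (ρ : Set (Fin d → ℝ)) := fun h => hv (neg_mem_iff.1 h)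
  obtain ⟨w, hw, hwT, hwF, t, ht, hwt⟩ := hT.exists_coface hF hd hρ hcard hv (hin v hvF)
  obtain ⟨w', hw', hwT', hwF', t', ht', hwt'⟩ := hT.exists_coface hF hd hρ hcard hv'
    (hin (-v) (neg_mem hvF))
  refine ⟨w, w', ?_, fun u => ⟨fun hu => ?_, ?_⟩⟩
  · rintro rfl
    have h1 := sub_mem hwt' hwt
    rw [show w - barycenter ρ - t' • -v - (w - barycenter ρ - t • v) = (t + t') • v by module,
      Submodule.smul_mem_iff _ (by positivity)] at h1
    exact hv h1
  · obtain ⟨s, hs, hus⟩ := hu.exists_ne_zero hρ hcard hρF hvF hv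
    rcases lt_or_gt_of_ne hs with hs | hs
    · right
      refine coface_unique hρ hv' hu.1 hw' hu.2.1 hwT' (neg_pos.2 hs) ht' ?_ hwt'
      simpa using hus
    · left
      exact coface_unique hρ hv hu.1 hw hu.2.1 hwT hs ht hus hwt
  · rintro (rfl | rfl)
    · exact ⟨hw, hwT, hwF⟩
    · exact ⟨hw', hwT', hwF'⟩

theorem apply_eq_zero_of_mem_vectorSpan {s : Set (Fin d → ℝ)} {i : Fin d} {a : ℝ}
    (hs : ∀ p ∈ s, p i = a) {u : Fin d → ℝ} (hu : u ∈ vectorSpan ℝ s) : u i = 0 := by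
  have h1 : vectorSpan ℝ s ≤ LinearMap.ker (LinearMap.proj (R := ℝ) (φ := fun _ => ℝ) i) := by
    rw [vectorSpan_def, Submodule.span_le]
    rintro _ ⟨p, hp, q, hq, rfl⟩
    simp [hs p hp, hs q hq]
  simpa using h1 hu

theorem single_not_mem_vectorSpan {s : Set (Fin d → ℝ)} {i : Fin d} {a c : ℝ} (hc : c ≠ 0)
    (hs : ∀ p ∈ s, p i = a) : (Pi.single i c : Fin d → ℝ) ∉ vectorSpan ℝ s := fun h =>
  hc (by simpa using apply_eq_zero_of_mem_vectorSpan hs h)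

/-- A codimension one simplex in a facet of a cell has exactly one coface in the cell. The sign `c`
tells which of the two facets in the direction `i` it is. -/
theorem exists_unique_coface (hT : IsSkeletonTriangulation d n r T) (hF : F ∈ box d n)
    (hd : cellDim F ≤ r) (hρ : ρ ∈ T.faces) (hcard : #ρ = cellDim F)
    (hρF : (ρ : Set (Fin d → ℝ)) ⊆ cubeSet F) {i : Fin d} (hi : Odd (F i)) {a c : ℝ}
    (hρi : ∀ p ∈ ρ, p i = a) (hc : c ≠ 0)
    (hside : ∀ x ∈ cubeSet F, 0 ≤ (x i - a) * c)
    (hstep : ∀ ε, 0 < ε → ε < 1 →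
      ((F i / 2 : ℕ) : ℝ) ≤ a + ε * c ∧ a + ε * c ≤ (((F i + 1) / 2 : ℕ) : ℝ)) :
    ∃ w, ∀ u, IsCoface T F ρ u ↔ u = w := by
  have hne := T.nonempty_of_mem_faces hρ
  have hx := barycenter_mem_cubeSet hne hρF
  have hxi : barycenter ρ i = a := by
    simp only [barycenter, Finset.sum_apply, Pi.smul_apply, smul_eq_mul]
    rw [sum_congr rfl fun p hp => by rw [hρi p hp], ← sum_mul, sum_inv_card hne, one_mul]
  -- This direction points from the facet into the cell; by `hside` every coface is on this side.
  set v : Fin d → ℝ := Pi.single i c with hvdef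
  have hv : v ∉ vectorSpan ℝ (ρ : Set (Fin d → ℝ)) := single_not_mem_vectorSpan hc hρi
  have hvF : v ∈ cellDirection F := by
    rw [mem_cellDirection]
    intro j hj
    rw [hvdef, Pi.single_eq_of_ne]
    rintro rfl
    exact hj hi
  have hin : ∀ᶠ ε : ℝ in 𝓝[>] 0, barycenter ρ + ε • v ∈ cubeSet F := by
    filter_upwards [Ioo_mem_nhdsGT (zero_lt_one (α := ℝ))] with ε hε j
    rcases eq_or_ne j i with rfl | hj
    · simpa [hvdef, hxi] using hstep ε hε.1 hε.2
    · simpa [hvdef, hj] using hx j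
  obtain ⟨w, hw, hwT, hwF, t, ht, hwt⟩ := hT.exists_coface hF hd hρ hcard hv hin
  refine ⟨w, fun u => ⟨fun hu => ?_, ?_⟩⟩
  · obtain ⟨s, hs, hus⟩ := hu.exists_ne_zero hρ hcard hρF hvF hv
    refine coface_unique hρ hv hu.1 hw hu.2.1 hwT (lt_of_le_of_ne ?_ hs.symm) ht hus hwt
    have h1 := apply_eq_zero_of_mem_vectorSpan hρi hus
    have h2 := hside u hu.2.2
    simp only [Pi.sub_apply, Pi.smul_apply, hvdef, Pi.single_eq_same, smul_eq_mul, hxi] at h1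
    rw [show u i - a = s * c by linarith, mul_assoc] at h2
    exact nonneg_of_mul_nonneg_left h2 (mul_self_pos.2 hc)
  · rintro rfl
    exact ⟨hw, hwT, hwF⟩

/-- A codimension one simplex of a cell lies on at most one facet. -/
theorem eq_of_subset_facets (hρ : ρ ∈ T.faces) (hcard : #ρ = cellDim F)
    (hρF : (ρ : Set (Fin d → ℝ)) ⊆ cubeSet F) {i j : Fin d} (hi : Odd (F i)) (hj : Odd (F j))
    {a b : ℝ} (hρi : ∀ p ∈ ρ, p i = a) (hρj : ∀ p ∈ ρ, p j = b) : i = j := by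
  by_contra hij
  have hne := T.nonempty_of_mem_faces hρ
  have hmem : ∀ k, Odd (F k) → (Pi.single k 1 : Fin d → ℝ) ∈ cellDirection F := by
    intro k hk
    rw [mem_cellDirection]
    intro l hl
    rw [Pi.single_eq_of_ne]
    rintro rfl
    exact hl hk
  -- For `i ≠ j` this vector has `j`-th coordinate `1`, but `ρ` is constant in that coordinate.
  obtain ⟨t, ht⟩ := exists_sub_smul_mem_vectorSpan (T.indep hρ) hne hcard hρF (hmem i hi)
    (single_not_mem_vectorSpan one_ne_zero hρi) (hmem j hj)
  have := apply_eq_zero_of_mem_vectorSpan hρj ht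
  simp [Ne.symm hij] at this

open Classical in
/-- The number of cofaces in a cell of a codimension one simplex `ρ` has the parity of the number
of the facets of the cell that contain `ρ`. -/
theorem card_cofaces (hT : IsSkeletonTriangulation d n r T) (hF : F ∈ box d n)
    (hd : cellDim F ≤ r) (hρ : ρ ∈ T.faces) (hcard : #ρ = cellDim F)
    (hρF : (ρ : Set (Fin d → ℝ)) ⊆ cubeSet F) (A : Finset (Finset (Fin d → ℝ)))
    (hA : ∀ σ, σ ∈ A ↔ ∃ w, IsCoface T F ρ w ∧ insert w ρ = σ) :
    (#A : ZMod 2) = ∑ i, if Odd (F i) then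
      (if (ρ : Set (Fin d → ℝ)) ⊆ cubeSet (update F i (F i - 1)) then 1 else 0) +
      (if (ρ : Set (Fin d → ℝ)) ⊆ cubeSet (update F i (F i + 1)) then 1 else 0) else 0 := by
  have hne := T.nonempty_of_mem_faces hρ
  by_cases hint : ∀ i, Odd (F i) → ¬ (ρ : Set (Fin d → ℝ)) ⊆ cubeSet (update F i (F i - 1)) ∧
      ¬ (ρ : Set (Fin d → ℝ)) ⊆ cubeSet (update F i (F i + 1))
  -- Interior case: two cofaces and no facet, and `2 = 0`.
  · obtain ⟨w, w', hww, hw⟩ := hT.exists_cofaces_of_interior hF hd hρ hcard hρF hint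
    have hAeq : A = {insert w ρ, insert w' ρ} := by
      ext σ
      rw [hA]
      simp only [hw, mem_insert, mem_singleton]
      grind
    have h1 := ((hw w).2 (Or.inl rfl)).1
    rw [hAeq, card_pair, sum_eq_zero]
    · rfl
    · intro i _
      split_ifs with h2 h3 h4 h4
      · exact absurd h3 (hint i h2).1
      · exact absurd h3 (hint i h2).1
      · exact absurd h4 (hint i h2).2
      · simp
      · rfl
    · intro h
      have h2 : w ∈ insert w' ρ := h ▸ mem_insert_self w ρ
      exact (mem_insert.1 h2).elim hww h1
  -- Boundary case: one coface and exactly one facet.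
  · have hcard1 : ∀ w, (∀ u, IsCoface T F ρ u ↔ u = w) → #A = 1 := by
      intro w hw
      rw [card_eq_one]
      refine ⟨insert w ρ, ?_⟩
      ext σ
      rw [hA]
      simp only [hw, mem_singleton]
      grind
    have hlow : ∀ i, Odd (F i) → (ρ : Set (Fin d → ℝ)) ⊆ cubeSet (update F i (F i - 1)) →
        ∀ p ∈ ρ, p i = (F i / 2 : ℕ) := fun i hi h p hp => ((mem_cubeSet_lower hi).1 (h hp)).2
    have hupp : ∀ i, Odd (F i) → (ρ : Set (Fin d → ℝ)) ⊆ cubeSet (update F i (F i + 1)) →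
        ∀ p ∈ ρ, p i = ((F i + 1) / 2 : ℕ) := fun i hi h p hp =>
      ((mem_cubeSet_upper hi).1 (h hp)).2
    have hcast : ∀ i, Odd (F i) → (((F i + 1) / 2 : ℕ) : ℝ) = (F i / 2 : ℕ) + 1 := by
      rintro i ⟨a, ha⟩
      rw [show (F i + 1) / 2 = F i / 2 + 1 by omega, Nat.cast_succ]
    push Not at hint
    obtain ⟨i, hi, hfac⟩ := hint
    have hother : ∀ j, j ≠ i → (∃ a, ∀ p ∈ ρ, p i = a) → (if Odd (F j) then
        (if (ρ : Set (Fin d → ℝ)) ⊆ cubeSet (update F j (F j - 1)) then 1 else 0) +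
        (if (ρ : Set (Fin d → ℝ)) ⊆ cubeSet (update F j (F j + 1)) then 1 else 0) else 0 :
          ZMod 2) = 0 := by
      rintro j hj ⟨a, ha⟩
      split_ifs with h2 h3 h4 h4
      · exact absurd (eq_of_subset_facets hρ hcard hρF h2 hi (hlow j h2 h3) ha) hj
      · exact absurd (eq_of_subset_facets hρ hcard hρF h2 hi (hlow j h2 h3) ha) hj
      · exact absurd (eq_of_subset_facets hρ hcard hρF h2 hi (hupp j h2 h4) ha) hj
      · simp
      · rfl
    obtain ⟨p, hp⟩ := hne
    by_cases hl : (ρ : Set (Fin d → ℝ)) ⊆ cubeSet (update F i (F i - 1))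
    · have hu : ¬ (ρ : Set (Fin d → ℝ)) ⊆ cubeSet (update F i (F i + 1)) := by
        intro hu
        have h1 := hlow i hi hl p hp
        have h2 := hupp i hi hu p hp
        rw [hcast i hi] at h2
        linarith
      rw [sum_eq_single i (fun j _ hj => hother j hj ⟨_, hlow i hi hl⟩) (by simp), if_pos hi,
        if_pos hl, if_neg hu]
      obtain ⟨w, hw⟩ := hT.exists_unique_coface hF hd hρ hcard hρF hi (hlow i hi hl)
        (one_ne_zero) (fun x hx => by linarith [(hx i).1])
        (fun ε h1 h2 => by rw [hcast i hi]; constructor <;> linarith)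
      rw [hcard1 w hw]
      simp
    · have hu := hfac hl
      rw [sum_eq_single i (fun j _ hj => hother j hj ⟨_, hupp i hi hu⟩) (by simp), if_pos hi,
        if_neg hl, if_pos hu]
      obtain ⟨w, hw⟩ := hT.exists_unique_coface hF hd hρ hcard hρF hi (hupp i hi hu)
        (c := -1) (by norm_num) (fun x hx => by linarith [(hx i).2])
        (fun ε h1 h2 => by rw [hcast i hi]; constructor <;> linarith)
      rw [hcard1 w hw]
      simp

end IsSkeletonTriangulation

end ColorCube

/-! ### The color cochains of a triangulation. -/

namespace ColorCube

open Finset Function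

open Classical in
/-- For a set `σ` with one point more than there are colors in `τ`, the parity of the number of
subsets of `σ` colored bijectively by `τ`. -/
theorem card_powersetCard_image_eq {α C : Type*} [Fintype C] (color : α → C) {σ : Finset α}
    {τ : Finset C} (hcard : #σ = #τ + 1) :
    (#{ρ ∈ powersetCard #τ σ | ρ.image color = τ} : ZMod 2) =
      ∑ v ∈ τᶜ, if σ.image color = insert v τ then 1 else 0 := by
  -- If `ρ₀` exists, `σ` is `ρ₀` with one more point `p`. When the color of `p` is in `τ`,
  -- exchanging `p` for the point `q` of that color gives exactly one further subset, and both sides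
  -- are `0`; otherwise `ρ₀` is the only one and both sides are `1`. If `ρ₀` does not exist, `σ`
  -- cannot be colored by any `insert v τ`, since deleting the point of color `v` would give such a
  -- subset.
  by_cases hex : ∃ ρ₀ ⊆ σ, #ρ₀ = #τ ∧ ρ₀.image color = τ
  · obtain ⟨ρ₀, hρσ, hρc, hρi⟩ := hex
    have hinj : ∀ ρ : Finset α, #ρ = #τ → ρ.image color = τ → Set.InjOn color ρ :=
      fun ρ h1 h2 => card_image_iff.1 (by rw [h2, h1])
    obtain ⟨p, hp, rfl⟩ := exists_eq_insert_iff.2 ⟨hρσ, (by rw [hρc, hcard] : #ρ₀ + 1 = #σ)⟩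
    have hsub : ∀ ρ, ρ ⊆ insert p ρ₀ → #ρ = #τ → p ∉ ρ → ρ = ρ₀ := by
      intro ρ h1 h2 h3
      exact eq_of_subset_of_card_le ((subset_insert_iff_of_notMem h3).1 h1) (by rw [h2, hρc])
    rw [image_insert, hρi]
    by_cases hpτ : color p ∈ τ
    · obtain ⟨q, hq, hqp⟩ := mem_image.1 (hρi ▸ hpτ)
      have hpe : p ∉ ρ₀.erase q := fun h => hp (mem_of_mem_erase h)
      have hec : #(insert p (ρ₀.erase q)) = #τ := by
        rw [card_insert_of_notMem hpe, card_erase_add_one hq, hρc]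
      have hfil : {ρ ∈ powersetCard #τ (insert p ρ₀) | ρ.image color = τ} =
          {ρ₀, insert p (ρ₀.erase q)} := by
        ext ρ
        simp only [mem_filter, mem_powersetCard, mem_insert, mem_singleton]
        constructor
        · rintro ⟨⟨h1, h2⟩, h3⟩
          by_cases hpρ : p ∈ ρ
          · right
            have hqρ : q ∉ ρ := fun hqρ => hp (hinj ρ h2 h3 hqρ hpρ hqp ▸ hq)
            refine eq_of_subset_of_card_le (fun x hx => ?_) (by rw [h2, hec])
            rcases mem_insert.1 (h1 hx) with rfl | h
            · exact mem_insert_self _ _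
            · exact mem_insert_of_mem (mem_erase.2 ⟨fun h => hqρ (h ▸ hx), h⟩)
          · exact Or.inl (hsub ρ h1 h2 hpρ)
        · rintro (rfl | rfl)
          · exact ⟨⟨hρσ, hρc⟩, hρi⟩
          · refine ⟨⟨insert_subset_insert _ (erase_subset _ _), hec⟩, ?_⟩
            rw [image_insert, ← hqp, ← image_insert, insert_erase hq, hρi]
      rw [hfil, card_pair (fun h : ρ₀ = _ => hp (by rw [h]; exact mem_insert_self _ _)), sum_eq_zero]
      · rfl
      · intro v hv
        rw [insert_eq_of_mem hpτ, if_neg]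
        exact fun h => mem_compl.1 hv (h ▸ mem_insert_self v τ)
    · have hfil : {ρ ∈ powersetCard #τ (insert p ρ₀) | ρ.image color = τ} = {ρ₀} := by
        ext ρ
        simp only [mem_filter, mem_powersetCard, mem_singleton]
        constructor
        · rintro ⟨⟨h1, h2⟩, h3⟩
          exact hsub ρ h1 h2 fun h => hpτ (h3 ▸ mem_image_of_mem color h)
        · rintro rfl
          exact ⟨⟨hρσ, hρc⟩, hρi⟩
      rw [hfil, sum_eq_single (color p)]
      · simp
      · intro v hv hne
        rw [if_neg]
        intro h
        have : v ∈ insert (color p) τ := h ▸ mem_insert_self v τ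
        exact (mem_insert.1 this).elim hne (mem_compl.1 hv)
      · exact fun h => absurd (mem_compl.2 hpτ) h
  · rw [card_eq_zero.2, sum_eq_zero]
    · rfl
    · intro v hv
      rw [if_neg]
      intro h
      have hv := mem_compl.1 hv
      obtain ⟨p, hp, rfl⟩ := mem_image.1 (h ▸ mem_insert_self v τ : v ∈ σ.image color)
      have hinj : Set.InjOn color σ :=
        card_image_iff.1 (by rw [h, card_insert_of_notMem hv, hcard])
      refine hex ⟨σ.erase p, erase_subset _ _, by rw [card_erase_of_mem hp, hcard]; rfl, ?_⟩
      refine eq_of_subset_of_card_le (fun x hx => ?_) ?_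
      · obtain ⟨y, hy, rfl⟩ := mem_image.1 hx
        have h1 := mem_image_of_mem color (mem_of_mem_erase hy)
        rw [h] at h1
        refine (mem_insert.1 h1).resolve_left fun h2 => ?_
        exact ne_of_mem_erase hy (hinj (mem_of_mem_erase hy) hp h2)
      · rw [card_image_of_injOn (hinj.mono (coe_subset.2 (erase_subset _ _))),
          card_erase_of_mem hp, hcard]
        rfl
    · rw [filter_eq_empty_iff]
      intro ρ hρ h
      rw [mem_powersetCard] at hρ
      exact hex ⟨ρ, hρ.1, hρ.2, h⟩

variable {d n r : ℕ} {T : Geometry.SimplicialComplex ℝ (Fin d → ℝ)}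

open Classical in
/-- The faces of `T` with `k` vertices that lie in a given cell. -/
noncomputable def cellFaces (n : ℕ) (T : Geometry.SimplicialComplex ℝ (Fin d → ℝ))
    (F : Fin d → ℕ) (k : ℕ) : Finset (Finset (Fin d → ℝ)) :=
  {σ ∈ (latticeFinset d n).powerset |
    σ ∈ T.faces ∧ #σ = k ∧ (σ : Set (Fin d → ℝ)) ⊆ cubeSet F}

open Classical in
theorem IsSkeletonTriangulation.mem_cellFaces (hT : IsSkeletonTriangulation d n r T)
    {F : Fin d → ℕ} {k : ℕ} {σ : Finset (Fin d → ℝ)} :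
    σ ∈ cellFaces n T F k ↔ σ ∈ T.faces ∧ #σ = k ∧ (σ : Set (Fin d → ℝ)) ⊆ cubeSet F := by
  rw [cellFaces, mem_filter, mem_powerset]
  exact ⟨And.right, fun h => ⟨hT.subset_latticeFinset h.1, h⟩⟩

open Classical in
/-- The cochain counting the simplices of a cell that are colored bijectively by `τ`. -/
noncomputable def colorCochain {C : Type*} (n : ℕ) (T : Geometry.SimplicialComplex ℝ (Fin d → ℝ))
    (color : (Fin d → ℝ) → C) (τ : Finset C) (F : Fin d → ℕ) : ZMod 2 :=
  if #τ = cellDim F + 1 then (#{σ ∈ cellFaces n T F #τ | σ.image color = τ} : ZMod 2) else 0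

theorem cellDim_update_add_one {F : Fin d → ℕ} {i : Fin d} (hi : Odd (F i)) {e : ℕ}
    (he : Even e) : cellDim (update F i e) + 1 = cellDim F := by
  have h := cellDim_update_of_odd (F := update F i e) (i := i) (by simpa) hi
  rw [update_idem, update_eq_self] at h
  exact h.symm

open Classical in
theorem IsSkeletonTriangulation.card_facet_faces {C : Type*}
    (hT : IsSkeletonTriangulation d n r T) (color : (Fin d → ℝ) → C) (τ : Finset C)
    {F G : Fin d → ℕ} (hGF : cubeSet G ⊆ cubeSet F) (k : ℕ) :
    (#{ρ ∈ cellFaces n T G k | ρ.image color = τ} : ZMod 2) =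
      ∑ ρ ∈ cellFaces n T F k with ρ.image color = τ,
        if (ρ : Set (Fin d → ℝ)) ⊆ cubeSet G then 1 else 0 := by
  rw [← natCast_card_filter]
  congr 2
  ext ρ
  simp only [mem_filter, hT.mem_cellFaces]
  exact ⟨fun h => ⟨⟨⟨h.1.1, h.1.2.1, h.1.2.2.trans hGF⟩, h.2⟩, h.1.2.2⟩,
    fun h => ⟨⟨h.1.1.1, h.1.1.2.1, h.2⟩, h.1.2⟩⟩

-- Double counting of pairs `ρ ⊆ σ` in the cell `F`, with `ρ` colored bijectively by `τ` and `σ` of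
-- full dimension. For fixed `ρ`, the parity of the number of `σ` is that of the facets containing
-- `ρ`, which yields the coboundary; for fixed `σ`, the parity of the number of `ρ` tells whether
-- `σ` is colored by some `insert v τ`. When `cellDim F ≠ #τ` both sides vanish by degree.
open Classical in
theorem IsSkeletonTriangulation.coboundary_colorCochain {C : Type*} [Fintype C]
    (hT : IsSkeletonTriangulation d n r T) (color : (Fin d → ℝ) → C) {τ : Finset C}
    (hne : τ.Nonempty) (hτ : #τ ≤ r) {F : Fin d → ℕ} (hF : F ∈ box d n) :
    coboundary (colorCochain n T color τ) F = ∑ v ∈ τᶜ, colorCochain n T color (insert v τ) F := by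
  have hev : ∀ i, Odd (F i) → Even (F i - 1) ∧ Even (F i + 1) := by
    rintro i ⟨a, ha⟩
    exact ⟨⟨a, by omega⟩, ⟨a + 1, by omega⟩⟩
  have hdim : ∀ i, Odd (F i) → cellDim (update F i (F i - 1)) + 1 = cellDim F ∧
      cellDim (update F i (F i + 1)) + 1 = cellDim F := fun i hi =>
    ⟨cellDim_update_add_one hi (hev i hi).1, cellDim_update_add_one hi (hev i hi).2⟩
  by_cases hk : #τ = cellDim F
  · set R := {ρ ∈ cellFaces n T F #τ | ρ.image color = τ} with hR
    set S := cellFaces n T F (#τ + 1) with hS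
    calc coboundary (colorCochain n T color τ) F
        = ∑ i, ∑ ρ ∈ R, if Odd (F i) then
          (if (ρ : Set (Fin d → ℝ)) ⊆ cubeSet (update F i (F i - 1)) then 1 else 0) +
          (if (ρ : Set (Fin d → ℝ)) ⊆ cubeSet (update F i (F i + 1)) then 1 else 0) else 0 := by
          unfold coboundary
          refine sum_congr rfl fun i _ => ?_
          by_cases hi : Odd (F i)
          · simp only [hi, if_true]
            rw [sum_add_distrib, colorCochain, if_pos (by rw [(hdim i hi).1, hk]), colorCochain,
              if_pos (by rw [(hdim i hi).2, hk]),
              hT.card_facet_faces color τ fun x hx => ((mem_cubeSet_lower hi).1 hx).1,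
              hT.card_facet_faces color τ fun x hx => ((mem_cubeSet_upper hi).1 hx).1]
          · simp [hi]
      _ = ∑ ρ ∈ R, (#{σ ∈ S | ρ ⊆ σ} : ZMod 2) := by
          rw [sum_comm]
          refine sum_congr rfl fun ρ hρ => ?_
          rw [hR, mem_filter, hT.mem_cellFaces] at hρ
          refine (hT.card_cofaces hF (hk ▸ hτ) hρ.1.1 (hρ.1.2.1.trans hk) hρ.1.2.2 _ ?_).symm
          intro σ
          rw [mem_filter, hS, hT.mem_cellFaces]
          constructor
          · rintro ⟨⟨h1, h2, h3⟩, h4⟩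
            obtain ⟨w, hw, rfl⟩ := exists_eq_insert_iff.2 ⟨h4, by rw [hρ.1.2.1, h2]⟩
            exact ⟨w, ⟨hw, h1, h3 (mem_coe.2 (mem_insert_self w ρ))⟩, rfl⟩
          · rintro ⟨w, ⟨h1, h2, h3⟩, rfl⟩
            refine ⟨⟨h2, by rw [card_insert_of_notMem h1, hρ.1.2.1], ?_⟩, subset_insert w ρ⟩
            rw [coe_insert]
            exact Set.insert_subset h3 hρ.1.2.2
      _ = ∑ σ ∈ S, (#{ρ ∈ R | ρ ⊆ σ} : ZMod 2) := by
          simp only [natCast_card_filter]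
          rw [sum_comm]
      _ = ∑ σ ∈ S, ∑ v ∈ τᶜ, if σ.image color = insert v τ then 1 else 0 := by
          refine sum_congr rfl fun σ hσ => ?_
          rw [hS, hT.mem_cellFaces] at hσ
          rw [← card_powersetCard_image_eq color hσ.2.1]
          congr 2
          ext ρ
          simp only [hR, mem_filter, hT.mem_cellFaces, mem_powersetCard]
          constructor
          · rintro ⟨⟨⟨-, h2, -⟩, h4⟩, h5⟩
            exact ⟨⟨h5, h2⟩, h4⟩
          · rintro ⟨⟨h1, h2⟩, h3⟩
            exact ⟨⟨⟨T.down_closed hσ.1 h1 (card_pos.1 (h2 ▸ hne.card_pos)), h2,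
              (coe_subset.2 h1).trans hσ.2.2⟩, h3⟩, h1⟩
      _ = _ := by
          rw [sum_comm]
          refine sum_congr rfl fun v hv => ?_
          rw [colorCochain, card_insert_of_notMem (mem_compl.1 hv), if_pos (by rw [hk]),
            natCast_card_filter]
  · rw [sum_eq_zero]
    · unfold coboundary
      refine sum_eq_zero fun i _ => ?_
      split_ifs with hi
      · rw [colorCochain, if_neg (by rw [(hdim i hi).1]; exact hk), colorCochain,
          if_neg (by rw [(hdim i hi).2]; exact hk), add_zero]
      · rfl
    · intro v hv
      rw [colorCochain, if_neg]
      rw [card_insert_of_notMem (mem_compl.1 hv)]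
      omega

theorem hasDegree_colorCochain {C : Type*} (color : (Fin d → ℝ) → C) {k : ℕ} {τ : Finset C}
    (hτ : #τ = k + 1) : HasDegree n k (colorCochain n T color τ) := by
  intro F _ h
  unfold colorCochain at h
  split_ifs at h with h1
  · omega
  · exact absurd rfl h

theorem exists_face_of_colorCochain_ne_zero {C : Type*} [DecidableEq C] {color : (Fin d → ℝ) → C}
    (hT : IsSkeletonTriangulation d n r T) {τ : Finset C} {F : Fin d → ℕ}
    (h : colorCochain n T color τ F ≠ 0) : ∃ σ ∈ T.faces, #σ = #τ ∧
      (σ : Set (Fin d → ℝ)) ⊆ cubeSet F ∧ σ.image color = τ := by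
  unfold colorCochain at h
  split_ifs at h with h1
  · have h2 : #{σ ∈ cellFaces n T F #τ | σ.image color = τ} ≠ 0 := by
      intro h0
      refine h ?_
      convert! Nat.cast_zero
      convert! h0
    obtain ⟨σ, hσ⟩ := card_pos.1 (Nat.pos_of_ne_zero h2)
    rw [mem_filter, hT.mem_cellFaces] at hσ
    exact ⟨σ, hσ.1.1, hσ.1.2.1, hσ.1.2.2, hσ.2⟩
  · exact absurd rfl h

theorem IsSkeletonTriangulation.sum_colorCochain_singleton {C : Type*} [Fintype C] [DecidableEq C]
    (hT : IsSkeletonTriangulation d n r T) (color : (Fin d → ℝ) → C) :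
    ∑ v, colorCochain n T color {v} 0 = 1 := by
  have h0 : ({0} : Finset (Fin d → ℝ)) ∈ T.faces := by
    change (0 : Fin d → ℝ) ∈ T.vertices
    rw [hT.vertices_eq]
    exact ⟨0, fun _ => Nat.zero_le _, by ext; simp⟩
  have hfaces : cellFaces n T (0 : Fin d → ℕ) 1 = {{0}} := by
    ext σ
    rw [hT.mem_cellFaces, mem_singleton]
    constructor
    · rintro ⟨-, h1, h2⟩
      obtain ⟨p, rfl⟩ := card_eq_one.1 h1
      congr 1
      ext i
      have := h2 (by simp : p ∈ _) i
      simp only [Pi.zero_apply, Nat.zero_div, Nat.cast_zero, zero_add] at this ⊢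
      norm_num at this
      linarith [this.1, this.2]
    · rintro rfl
      refine ⟨h0, card_singleton _, ?_⟩
      intro x hx i
      simp only [coe_singleton, Set.mem_singleton_iff] at hx
      simp [hx]
  have hval : ∀ v, colorCochain n T color {v} 0 = if color 0 = v then 1 else 0 := by
    intro v
    rw [colorCochain, if_pos (by simp [cellDim]), card_singleton, hfaces, filter_singleton]
    simp only [image_singleton, singleton_inj]
    split_ifs <;> simp
  simp [hval]

theorem card_cells_at_le {u : Fin d → ℝ} (hu : u ∈ latticeFinset d n) (A : Finset (Fin d → ℕ))
    (hA : ∀ F ∈ A, u ∈ cubeSet F) : #A ≤ 3 ^ d := by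
  obtain ⟨a, -, rfl⟩ := mem_image.1 hu
  calc #A ≤ #(Fintype.piFinset fun i => Icc (2 * a i - 1) (2 * a i + 1)) := by
        refine card_le_card fun F hF => ?_
        rw [Fintype.mem_piFinset]
        intro i
        obtain ⟨h1, h2⟩ := hA F hF i
        rw [Nat.cast_le] at h1 h2
        rw [mem_Icc]
        omega
    _ ≤ ∏ _i : Fin d, 3 := by
        rw [Fintype.card_piFinset]
        refine prod_le_prod' fun i _ => ?_
        rw [Nat.card_Icc]
        omega
    _ = _ := by simp

theorem card_lattice_in_cell_le (F : Fin d → ℕ) (A : Finset (Fin d → ℝ))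
    (hA : A ⊆ latticeFinset d n) (hAF : ∀ u ∈ A, u ∈ cubeSet F) : #A ≤ 2 ^ d := by
  calc #A ≤ #((Fintype.piFinset fun i => Icc (F i / 2) ((F i + 1) / 2)).image
        fun a i => (a i : ℝ)) := by
        refine card_le_card fun u hu => ?_
        obtain ⟨a, -, rfl⟩ := mem_image.1 (hA hu)
        refine mem_image.2 ⟨a, ?_, rfl⟩
        rw [Fintype.mem_piFinset]
        intro i
        obtain ⟨h1, h2⟩ := hAF _ hu i
        rw [Nat.cast_le] at h1 h2
        rw [mem_Icc]
        omega
    _ ≤ ∏ _i : Fin d, 2 := by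
        refine card_image_le.trans ?_
        rw [Fintype.card_piFinset]
        refine prod_le_prod' fun i _ => ?_
        rw [Nat.card_Icc]
        omega
    _ = _ := by simp

/-- A pair `(τ, F)` that counts comes from a simplex in `F` with a vertex `u` of color `v`. There
are at most `3 ^ d` cells at `u`, and at most `2 ^ 2 ^ d` sets of lattice points in a cell. -/
theorem IsSkeletonTriangulation.sum_supportCard_colorCochain_le {C : Type*} [Fintype C]
    [DecidableEq C] (hT : IsSkeletonTriangulation d n r T) (color : (Fin d → ℝ) → C) (v : C) :
    ∑ τ with v ∈ τ, supportCard n (colorCochain n T color τ) ≤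
      #{u ∈ latticeFinset d n | color u = v} * (3 ^ d * 2 ^ 2 ^ d) := by
  classical
  unfold supportCard
  rw [← card_sigma]
  calc _ ≤ #({u ∈ latticeFinset d n | color u = v}.biUnion fun u =>
        ({F ∈ box d n | u ∈ cubeSet F}).biUnion fun F =>
          ({p ∈ latticeFinset d n | p ∈ cubeSet F}).powerset.image fun σ =>
            (⟨σ.image color, F⟩ : (_ : Finset C) × (Fin d → ℕ))) := by
        refine card_le_card ?_
        rintro ⟨τ, F⟩ h
        simp only [mem_sigma, mem_filter, mem_univ, true_and] at h
        obtain ⟨hv, hF, hne⟩ := h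
        obtain ⟨σ, hσ, -, hσF, rfl⟩ := exists_face_of_colorCochain_ne_zero hT hne
        obtain ⟨u, hu, rfl⟩ := mem_image.1 hv
        have hσL := hT.subset_latticeFinset hσ
        simp only [mem_biUnion, mem_filter, mem_image, mem_powerset]
        exact ⟨u, ⟨hσL hu, rfl⟩, F, ⟨hF, hσF hu⟩, σ,
          fun p hp => mem_filter.2 ⟨hσL hp, hσF hp⟩, rfl⟩
    _ ≤ _ := by
        refine card_biUnion_le_card_mul _ _ _ fun u hu => ?_
        refine (card_biUnion_le_card_mul _ _ (2 ^ 2 ^ d) fun F hF => ?_).trans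
          (Nat.mul_le_mul_right _ ?_)
        · refine card_image_le.trans ?_
          rw [card_powerset]
          exact Nat.pow_le_pow_right (by norm_num)
            (card_lattice_in_cell_le F _ (filter_subset _ _) fun u hu => (mem_filter.1 hu).2)
        · exact card_cells_at_le (mem_filter.1 hu).1 _ fun F hF => (mem_filter.1 hF).2

theorem IsSkeletonTriangulation.isColorCochain {m N : ℕ} {C : Type*} [Fintype C] [DecidableEq C]
    (hT : IsSkeletonTriangulation d n (m + 1) T) (color : (Fin d → ℝ) → C)
    (hcolor : ∀ σ ∈ T.faces, #σ = m + 2 → #(σ.image color) ≠ m + 2)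
    (hN : ∀ v, #{u ∈ latticeFinset d n | color u = v} ≤ N) :
    IsColorCochain d n m (N * (3 ^ d * 2 ^ 2 ^ d)) (colorCochain n T color) where
  hasDegree _ _ := hasDegree_colorCochain color
  coboundary_eq τ hne hτ F hF := by
    convert! hT.coboundary_colorCochain color hne hτ hF
  eq_zero τ hτ F hF := by
    by_contra h
    obtain ⟨σ, hσ, h1, -, h2⟩ := exists_face_of_colorCochain_ne_zero hT h
    exact hcolor σ hσ (h1.trans hτ) (by rw [h2, hτ])
  augmentation := hT.sum_colorCochain_singleton color
  sum_supportCard_le v :=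
    (hT.sum_supportCard_colorCochain_le color v).trans (Nat.mul_le_mul_right _ (hN v))

end ColorCube

/-! ### Large color classes and large components. -/

namespace ColorCube

open Finset Function

variable {d n m : ℕ} {T : Geometry.SimplicialComplex ℝ (Fin d → ℝ)}

/-- The reciprocal of the constant in the theorem on large monochromatic sets. -/
def classConst (d m : ℕ) : ℕ := (1 + 2 * fillingConst d m m) * (3 ^ d * 2 ^ 2 ^ d)

theorem classConst_pos (d m : ℕ) : 0 < classConst d m := by
  unfold classConst
  positivity

theorem IsSkeletonTriangulation.pow_le_of_card_le {N : ℕ} {C : Type*} [Fintype C] [DecidableEq C]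
    (hT : IsSkeletonTriangulation d n (m + 1) T) (hn : 0 < n) (hm : m ≤ d)
    (color : (Fin d → ℝ) → C)
    (hcolor : ∀ σ ∈ T.faces, #σ = m + 2 → #(σ.image color) ≠ m + 2)
    (hN : ∀ v, #{u ∈ latticeFinset d n | color u = v} ≤ N) :
    n ^ (d - m) ≤ classConst d m * N := by
  have h := (hT.isColorCochain color hcolor hN).pow_le hn
  refine le_of_mul_le_mul_left (a := n ^ m) ?_ (Nat.pow_pos hn)
  calc n ^ m * n ^ (d - m) = n ^ d := by rw [← pow_add]; congr 1; omega
    _ ≤ _ := h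
    _ = _ := by unfold classConst; ring

theorem zero_mem_latticeFinset (d n : ℕ) : (0 : Fin d → ℝ) ∈ latticeFinset d n :=
  mem_image.2 ⟨0, by simp, by ext; simp⟩

open Classical in
/-- A coloring without rainbow `(m + 1)`-simplices has a large color class. -/
theorem IsSkeletonTriangulation.exists_large_class {C : Type*}
    (hT : IsSkeletonTriangulation d n (m + 1) T) (hn : 0 < n) (hm : m ≤ d)
    (color : (Fin d → ℝ) → C)
    (hcolor : ∀ σ ∈ T.faces, #σ = m + 2 → #(σ.image color) ≠ m + 2) :
    ∃ c, n ^ (d - m) ≤ classConst d m * #{u ∈ latticeFinset d n | color u = c} := by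
  -- `C` may be infinite, so the coloring is restricted to the colors that occur; off the lattice
  -- the value `c₀` is a harmless default.
  set P := (latticeFinset d n).image color
  have hP : ∀ u ∈ latticeFinset d n, color u ∈ P := fun u hu => mem_image_of_mem color hu
  set c₀ : P := ⟨color 0, hP 0 (zero_mem_latticeFinset d n)⟩
  set color' : (Fin d → ℝ) → P := fun u => if h : color u ∈ P then ⟨color u, h⟩ else c₀
  have hval : ∀ u ∈ latticeFinset d n, (color' u : C) = color u := fun u hu => by
    simp only [color', hP u hu, dif_pos]
  have : Nonempty P := ⟨c₀⟩
  obtain ⟨c, hc⟩ := Finite.exists_max fun c : P => #{u ∈ latticeFinset d n | color' u = c}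
  refine ⟨c, ?_⟩
  have h := hT.pow_le_of_card_le hn hm color' (fun σ hσ hcard h => ?_) hc
  · have hfil : {u ∈ latticeFinset d n | color' u = c} =
        {u ∈ latticeFinset d n | color u = c} := filter_congr fun u hu => by
      rw [← hval u hu, Subtype.ext_iff]
    rwa [hfil] at h
  · refine hcolor σ hσ hcard ?_
    rw [← h, ← card_image_of_injective (σ.image color') Subtype.val_injective, image_image]
    congr 1
    exact image_congr fun u hu => (hval u (hT.subset_latticeFinset hσ hu)).symm

/-- The adjacency graph without the edges between points of different colors. -/
def monochromaticGraph {C : Type*} (T : Geometry.SimplicialComplex ℝ (Fin d → ℝ)) (k : ℕ)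
    (color : (Fin d → ℝ) → C) : SimpleGraph (Fin d → ℝ) where
  Adj u v := (adjacencyGraph T k).Adj u v ∧ color u = color v
  symm := ⟨fun _ _ h => ⟨h.1.symm, h.2.symm⟩⟩
  loopless := ⟨fun _ h => h.1.ne rfl⟩

theorem color_eq_and_mem_of_reachable {C : Type*} {color : (Fin d → ℝ) → C} {k : ℕ}
    (hT : IsSkeletonTriangulation d n k T) {l : ℕ} {u v : Fin d → ℝ}
    (h : (monochromaticGraph T l color).Reachable u v) (hu : u ∈ latticeFinset d n) :
    color v = color u ∧ v ∈ latticeFinset d n := by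
  obtain ⟨p⟩ := h
  induction p with
  | nil => exact ⟨rfl, hu⟩
  | cons hadj _ ih =>
    obtain ⟨⟨-, σ, hσ, -, -, hv⟩, hc⟩ := hadj
    obtain ⟨h1, h2⟩ := ih (hT.subset_latticeFinset hσ hv)
    exact ⟨h1.trans hc.symm, h2⟩

theorem IsSkeletonTriangulation.vertices_eq_coe {k : ℕ} (hT : IsSkeletonTriangulation d n k T) :
    T.vertices = latticeFinset d n := by
  rw [hT.vertices_eq, coe_latticeFinset]

end ColorCube

theorem theorem1 (d m : ℕ) (hm : m < d) :
    ∃ f : ℝ, 0 < f ∧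
      ∀ (n : ℕ), 0 < n →
      ∀ T : Geometry.SimplicialComplex ℝ (Fin d → ℝ),
        ColorCube.IsSkeletonTriangulation d n (m + 1) T →
      ∀ {C : Type*} (color : (Fin d → ℝ) → C),
        (∀ σ ∈ T.faces, σ.card = m + 2 →
          (color '' (σ : Set (Fin d → ℝ))).ncard ≠ m + 2) →
        ∃ c : C,
          f * (n : ℝ) ^ (d - m) ≤ ((ColorCube.colorClass T color c).ncard : ℝ) ∧
          ∃ S : Finset (Fin d → ℝ),
            (S : Set (Fin d → ℝ)) ⊆ ColorCube.colorClass T color c ∧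
            ((ColorCube.adjacencyGraph T (m + 1)).induce (S : Set (Fin d → ℝ))).Connected ∧
            f * (n : ℝ) ^ (d - m) ≤ (S.card : ℝ) := by
  classical
  have hM : (0 : ℝ) < ColorCube.classConst d m := Nat.cast_pos.2 (ColorCube.classConst_pos d m)
  refine ⟨(ColorCube.classConst d m : ℝ)⁻¹, inv_pos.2 hM, ?_⟩
  intro n hn T hT C color hcolor
  set H := ColorCube.monochromaticGraph T (m + 1) color with hH
  -- The new color of a vertex is its monochromatic component. If the vertices of an `(m +
  -- 1)`-simplex are in distinct components, their original colors are distinct, because vertices of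
  -- equal color in it are adjacent in `H`.
  obtain ⟨K, hK⟩ := hT.exists_large_class hn hm.le H.connectedComponentMk (by
    intro σ hσ hcard h
    refine hcolor σ hσ hcard ?_
    rw [← hcard] at h ⊢
    rw [Set.InjOn.ncard_image, Set.ncard_coe_finset]
    intro u hu v hv huv
    by_contra hne
    refine hne (Finset.card_image_iff.1 h hu hv ?_)
    rw [SimpleGraph.ConnectedComponent.eq]
    exact SimpleGraph.Adj.reachable ⟨⟨hne, σ, hσ, hcard, hu, hv⟩, huv⟩)
  set S := (ColorCube.latticeFinset d n).filter fun u => H.connectedComponentMk u = K with hS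
  have hcardS : (ColorCube.classConst d m : ℝ)⁻¹ * (n : ℝ) ^ (d - m) ≤ (S.card : ℝ) := by
    rw [inv_mul_le_iff₀ hM]
    exact_mod_cast hK
  obtain ⟨u, hu⟩ : S.Nonempty := by
    rw [← Finset.card_pos]
    exact pos_of_mul_pos_right ((Nat.pow_pos hn).trans_le hK) (Nat.zero_le _)
  obtain ⟨huL, hu⟩ := Finset.mem_filter.1 hu
  have hprop : ∀ v, H.connectedComponentMk v = K →
      color v = color u ∧ v ∈ ColorCube.latticeFinset d n := by
    intro v hv
    refine ColorCube.color_eq_and_mem_of_reachable (l := m + 1) hT ?_ huL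
    exact SimpleGraph.ConnectedComponent.eq.1 (hu.trans hv.symm)
  -- `H` is a graph on the whole space, but a component that contains a lattice point consists of
  -- lattice points, so `S` is all of `K` and is connected.
  have hsupp : (S : Set (Fin d → ℝ)) = K.supp := by
    ext v
    rw [Finset.mem_coe, hS, Finset.mem_filter, SimpleGraph.ConnectedComponent.mem_supp_iff]
    exact ⟨And.right, fun h => ⟨(hprop v h).2, h⟩⟩
  have hsub : (S : Set (Fin d → ℝ)) ⊆ ColorCube.colorClass T color (color u) := by
    intro v hv
    rw [hsupp, SimpleGraph.ConnectedComponent.mem_supp_iff] at hv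
    refine ⟨?_, (hprop v hv).1⟩
    rw [hT.vertices_eq_coe]
    exact (hprop v hv).2
  refine ⟨color u, hcardS.trans ?_, S, hsub, ?_, hcardS⟩
  · rw [Nat.cast_le, ← Set.ncard_coe_finset]
    refine Set.ncard_le_ncard hsub ?_
    refine (ColorCube.latticeFinset d n).finite_toSet.subset fun v hv => ?_
    rw [← hT.vertices_eq_coe]
    exact hv.1
  · have hle : H ≤ ColorCube.adjacencyGraph T (m + 1) := fun _ _ h => h.1
    rw [hsupp]
    exact SimpleGraph.Connected.mono (fun u v h => hle h) K.connected_toSimpleGraph
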